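/- Let $n\ge 0$. (1) *Increasing ordered trees.* An increasing ordered tree on $n+1$ nodes is a rooted tree with nodes labeled $0,1,\dots,n$ in which the labels increase along each path from the root to a leaf, together with a total order of the children of each node. The number of increasing ordered trees on $n+1$ nodes is $$\sum_{\pi=\pi_1|\cdots|\pi_k} k!\,\cdot\,(2|\pi_1|-3)!!\cdots(2|\pi_k|-3)!!,$$ where the sum is over all partitions $\pi$ of $\{1,\dots,n\}$, $k$ is the number of blocks of $\pi$, and $(-1)!!=1$. (2) *Decreasing chains.* Let $\Sigma$ be a finite totally ordered set, and let $[[n]]=\{1,\bar1,\dots,n,\bar n\}$ with the involution $i\leftrightarrow\bar i$. A $\Sigma$-labeled partition of $[[n]]$ is a partition $\pi$ of $[[n]]$ such that $\overline R\in\pi$ for every $R\in\pi$, together with an injective assignment of signs in $\Sigma$ to some of its blocks, a block $R$ being signed if and only if $R=\overline R$. Write $\pi_\sigma$ for the block of sign $\sigma$ (empty if there is none) and $\Sigma(\pi)$ for the set of signs that occur. Put $\pi\preceq\psi$ if $\pi_\sigma\subseteq\psi_\sigma$ for all $\sigma\in\Sigma(\pi)$ and every unsigned block of $\pi$ is contained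 in a block of $\psi$. Let $\Pi_{n,\Sigma}$ be the poset of these labeled partitions with a top element $\hat1$ added; let $\hat0=1|\bar1|\cdots|n|\bar n$, and let $[n]_\sigma$ be the labeled partition whose only block is $[[n]]$, with sign $\sigma$ (the empty partition if $n=0$). The representative $r(R)$ of a block $R$ is the least $i\in\{1,\dots,n\}$ with $i\in R$ or $\bar i\in R$; $R$ is normalized if $r(R)\in R$. Label the covering relations $x\prec\!\cdot\; y$ of $\Pi_{n,\Sigma}$ by pairs of natural numbers, ordered lexicographically: - $(0,\max(r(R),r(R')))$ if $R\cup R'\in y$ for distinct normalized unsigned blocks $R,R'$ of $x$; - $(2,\min(r(R),r(R')))$ if $R\cup\overline{R'}\in y$ for distinct normalized unsigned blocks $R,R'$ of $x$; - if $x_\sigma\subsetneq y_\sigma$: $(1,|\{\tau\in\Sigma(x):\tau\le\sigma\}|)$ if $\sigma\in\Sigma(x)$, and $(1,|\{\tau\in\Sigma:\tau\le\sigma\}\cup\Sigma(x)|)$ otherwise; - $(1,2)$ if $y=\hat1$. The poset of type $C_n$ is $\Pi_{n,\Sigma}$; the poset of type $B_n$, for a distinguished sign $\overline\sigma\in\Sigma$,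 consists of $\hat1$ and the labeled partitions $x$ with $|x_\sigma|\ne2$ for all $\sigma\neq\overline\sigma$. In the linear case $\Sigma=\{\sigma\}$ (where $\overline\sigma=\sigma$ and types $B_n$ and $C_n$ coincide), the number of maximal chains from $\hat0$ to $[n]_\sigma$ in the poset of type $B_n=C_n$ whose word of labels, read from bottom to top, is weakly decreasing is $(2n-1)!!$. -/

import Mathlib

open scoped Nat

/-- The set `[[n]] = {1, 1̄, …, n, n̄}`: the pair `(i, false)` is the element `i + 1` of
`{1, …, n}`, and `(i, true)` is its barred copy. -/
abbrev Letter (n : ℕ) : Type := Fin n × Bool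

/-- The involution `i ↦ ī`, `ī ↦ i` of `[[n]]`. -/
def bar {n : ℕ} (a : Letter n) : Letter n := (a.1, !a.2)

/-- The subset `X̄ = {x̄ | x ∈ X}`. -/
def barSet {n : ℕ} (X : Finset (Letter n)) : Finset (Letter n) := X.image bar

/-- A `S`-labeled partition of `[[n]]`: a partition of `[[n]]` closed under `R ↦ R̄`, together with
an injection into `S` defined on a subset of the blocks (the signed blocks), such that a block is
signed exactly when it equals its own bar. The partial map on blocks is the map `sign`, which is
`none` on unsigned blocks and on sets that are not blocks. -/
@[ext]
structure LabeledPartition (n : ℕ) (S : Type*) where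
  partition : Finpartition (Finset.univ : Finset (Letter n))
  sign : Finset (Letter n) → Option S
  bar_mem : ∀ R ∈ partition.parts, barSet R ∈ partition.parts
  signed_iff : ∀ R, (sign R).isSome ↔ R ∈ partition.parts ∧ barSet R = R
  sign_inj : ∀ R R' σ, sign R = some σ → sign R' = some σ → R = R'

namespace LabeledPartition

variable {n : ℕ} {S : Type*}

/-- `π.Refines ψ`: every signed block of `π` lies in the block of `ψ` with the same sign, and every
unsigned block `R` of `π` lies in a block `T` of `ψ` with `R̄ ⊆ T̄`. -/
def Refines (π ψ : LabeledPartition n S) : Prop :=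
  (∀ B σ, π.sign B = some σ → ∃ C, ψ.sign C = some σ ∧ B ⊆ C) ∧
  (∀ R ∈ π.partition.parts, π.sign R = none →
    ∃ T ∈ ψ.partition.parts, R ⊆ T ∧ barSet R ⊆ barSet T)

theorem mem_of_sign {π : LabeledPartition n S} {B : Finset (Letter n)} {σ : S}
    (h : π.sign B = some σ) : B ∈ π.partition.parts :=
  ((π.signed_iff B).1 (by simp [h])).1

theorem Refines.partition_le {π ψ : LabeledPartition n S} (h : π.Refines ψ) :
    π.partition ≤ ψ.partition := by
  intro B hB
  rcases hs : π.sign B with _ | σ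
  · obtain ⟨T, hT, hBT, _⟩ := h.2 B hB hs
    exact ⟨T, hT, hBT⟩
  · obtain ⟨C, hC, hBC⟩ := h.1 B σ hs
    exact ⟨C, mem_of_sign hC, hBC⟩

theorem Refines.sign_eq {π ψ : LabeledPartition n S} (h : π.Refines ψ)
    (hp : π.partition = ψ.partition) {B : Finset (Letter n)} {σ : S}
    (hB : π.sign B = some σ) : ψ.sign B = some σ := by
  obtain ⟨C, hC, hBC⟩ := h.1 B σ hB
  have hB' : B ∈ ψ.partition.parts := hp ▸ mem_of_sign hB
  obtain ⟨a, ha⟩ := ψ.partition.nonempty_of_mem_parts hB'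
  rwa [ψ.partition.eq_of_mem_parts hB' (mem_of_sign hC) ha (hBC ha)]

instance : PartialOrder (LabeledPartition n S) where
  le := Refines
  le_refl π := ⟨fun B _ h => ⟨B, h, subset_rfl⟩, fun R hR _ => ⟨R, hR, subset_rfl, subset_rfl⟩⟩
  le_trans π ψ ω h₁ h₂ := by
    refine ⟨fun B σ hB => ?_, fun R hR hs => ?_⟩
    · obtain ⟨C, hC, hBC⟩ := h₁.1 B σ hB
      obtain ⟨D, hD, hCD⟩ := h₂.1 C σ hC
      exact ⟨D, hD, hBC.trans hCD⟩
    · obtain ⟨D, hD, hRD⟩ := (Refines.partition_le h₁).trans (Refines.partition_le h₂) hR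
      exact ⟨D, hD, hRD, Finset.image_subset_image hRD⟩
  le_antisymm π ψ h₁ h₂ := by
    have hp : π.partition = ψ.partition :=
      le_antisymm (Refines.partition_le h₁) (Refines.partition_le h₂)
    refine LabeledPartition.ext hp ?_
    funext B
    rcases h : π.sign B with _ | σ
    · rcases h' : ψ.sign B with _ | τ
      · rfl
      · rw [Refines.sign_eq h₂ hp.symm h'] at h
        cases h
    · rw [Refines.sign_eq h₁ hp h]

/-- The set `Σ(π)` of signs that occur in `π`. -/
noncomputable def signs [Fintype S] (π : LabeledPartition n S) : Finset S :=
  open scoped Classical in Finset.univ.filter fun σ => ∃ B, π.sign B = some σ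

/-- The signed block `π_σ`; it is empty if the sign `σ` does not occur in `π`. -/
noncomputable def signedBlock (π : LabeledPartition n S) (σ : S) : Finset (Letter n) :=
  open scoped Classical in Finset.univ.filter fun a => ∃ B, π.sign B = some σ ∧ a ∈ B

/-- The finest labeled partition `0̂ = 1 | 1̄ | ⋯ | n | n̄`. -/
def zeroHat (n : ℕ) (S : Type*) : LabeledPartition n S where
  partition := ⊥
  sign _ := none
  bar_mem R hR := by
    rw [Finpartition.mem_bot_iff] at hR ⊢
    obtain ⟨a, _, rfl⟩ := hR
    exact ⟨bar a, Finset.mem_univ _, by simp [barSet]⟩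
  signed_iff R := by
    simp only [Option.isSome_none, Bool.false_eq_true, false_iff, not_and]
    intro hR
    rw [Finpartition.mem_bot_iff] at hR
    obtain ⟨a, _, rfl⟩ := hR
    simp [barSet, bar, Prod.ext_iff]
  sign_inj R R' σ h := by cases h

/-- The labeled partition `[n]_σ` whose only block is the whole of `[[n]]`, with sign `σ`
(for `n = 0`, where there are no nonempty blocks, it is the empty partition). -/
def full (n : ℕ) {S : Type*} (σ : S) : LabeledPartition n S where
  partition := ⊤
  sign B := if B ∈ (⊤ : Finpartition (Finset.univ : Finset (Letter n))).parts then some σ else none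
  bar_mem R hR := by
    have h := Finset.mem_singleton.1 (Finpartition.parts_top_subset _ hR)
    have h2 : barSet R = R := by
      subst h
      refine Finset.eq_univ_of_forall fun a => ?_
      exact Finset.mem_image.2 ⟨bar a, Finset.mem_univ _, by simp [bar]⟩
    rwa [h2]
  signed_iff R := by
    by_cases hR : R ∈ (⊤ : Finpartition (Finset.univ : Finset (Letter n))).parts
    · have h := Finset.mem_singleton.1 (Finpartition.parts_top_subset _ hR)
      have h2 : barSet R = R := by
        subst h
        refine Finset.eq_univ_of_forall fun a => ?_
        exact Finset.mem_image.2 ⟨bar a, Finset.mem_univ _, by simp [bar]⟩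
      simp [hR, h2]
    · simp [hR]
  sign_inj R R' τ h h' := by
    have hR : R ∈ (⊤ : Finpartition (Finset.univ : Finset (Letter n))).parts := by
      by_contra hc
      simp [hc] at h
    have hR' : R' ∈ (⊤ : Finpartition (Finset.univ : Finset (Letter n))).parts := by
      by_contra hc
      simp [hc] at h'
    exact Finpartition.parts_top_subsingleton _ hR hR'

/-- The representative `r(R)` of a block: the least `i ∈ {1, …, n}` with `i ∈ R` or `ī ∈ R`. -/
noncomputable def rep (R : Finset (Letter n)) : ℕ := sInf {i : ℕ | ∃ a ∈ R, (a.1 : ℕ) + 1 = i}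

/-- `R` is normalized if it contains its representative (and not only its barred copy). -/
def IsNormalized (R : Finset (Letter n)) : Prop :=
  ∃ a ∈ R, a.2 = false ∧ (a.1 : ℕ) + 1 = rep R

/-- `R` is a normalized unsigned block of `x`. -/
def IsNormalizedUnsigned (x : LabeledPartition n S) (R : Finset (Letter n)) : Prop :=
  R ∈ x.partition.parts ∧ x.sign R = none ∧ IsNormalized R

/-- The edge from `x` to `y` is coherent: it merges the distinct normalized unsigned blocks
`p.1` and `p.2`. -/
def IsCoherentMerge (x y : LabeledPartition n S)
    (p : Finset (Letter n) × Finset (Letter n)) : Prop :=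
  IsNormalizedUnsigned x p.1 ∧ IsNormalizedUnsigned x p.2 ∧ p.1 ≠ p.2 ∧
    p.1 ∪ p.2 ∈ y.partition.parts

/-- The edge from `x` to `y` is non-coherent: it merges the normalized unsigned block `p.1` with
the bar of another normalized unsigned block `p.2`. -/
def IsNoncoherentMerge (x y : LabeledPartition n S)
    (p : Finset (Letter n) × Finset (Letter n)) : Prop :=
  IsNormalizedUnsigned x p.1 ∧ IsNormalizedUnsigned x p.2 ∧ p.1 ≠ p.2 ∧
    p.1 ∪ barSet p.2 ∈ y.partition.parts

open scoped Classical in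
/-- The label of the edge from `x` to `y`, for labeled partitions `x ⋖ y` (each such edge is of
exactly one of the three types: coherent, non-coherent, or of some sign `σ`). -/
noncomputable def label [Fintype S] [LinearOrder S] (x y : LabeledPartition n S) : ℕ ×ₗ ℕ :=
  if h : ∃ p, IsCoherentMerge x y p then
    toLex (0, max (rep h.choose.1) (rep h.choose.2))
  else if h : ∃ p, IsNoncoherentMerge x y p then
    toLex (2, min (rep h.choose.1) (rep h.choose.2))
  else if h : ∃ σ, x.signedBlock σ ⊂ y.signedBlock σ then
    if h.choose ∈ x.signs then
      toLex (1, (x.signs.filter (· ≤ h.choose)).card)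
    else
      toLex (1, (Finset.univ.filter (· ≤ h.choose) ∪ x.signs).card)
  else toLex (0, 0)

end LabeledPartition

/-- The poset `Π_{n,S}` of all `S`-labeled partitions of `[[n]]`, with a new top element `1̂`. -/
abbrev LabeledPartitionPoset (n : ℕ) (S : Type*) : Type _ := WithTop (LabeledPartition n S)

/-- The edge labeling of `Π_{n,S}` (its values matter only on pairs `x ⋖ y`). -/
noncomputable def edgeLabel {n : ℕ} {S : Type*} [Fintype S] [LinearOrder S] :
    LabeledPartitionPoset n S → LabeledPartitionPoset n S → ℕ ×ₗ ℕ
  | .some x, .some y => LabeledPartition.label x y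
  | .some _, none => toLex (1, 2)
  | none, _ => toLex (0, 0)

/-- Type `C_n`: all of `Π_{n,S}`. -/
def typeC (n : ℕ) (S : Type*) : Set (LabeledPartitionPoset n S) := Set.univ

/-- Type `B_n` with distinguished sign `σ₀`: no block of a sign other than `σ₀` has two elements. -/
def typeB (n : ℕ) {S : Type*} (σ₀ : S) : Set (LabeledPartitionPoset n S) :=
  {x | ∀ π : LabeledPartition n S, x = ↑π → ∀ σ, σ ≠ σ₀ → (π.signedBlock σ).card ≠ 2}

/-- The maximal chains `x = z₀ ⋖ z₁ ⋖ ⋯ ⋖ z_t = y` from `x` to `y` in the subposet `Q` of `Π_{n,S}`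
(`⋖` is the covering relation of `Q`) whose word of edge labels is weakly decreasing. -/
def decreasingMaximalChains {n : ℕ} {S : Type*} [Fintype S] [LinearOrder S]
    (Q : Set (LabeledPartitionPoset n S)) (x y : LabeledPartitionPoset n S) : Set (List Q) :=
  {c | (c.map Subtype.val).head? = some x ∧ (c.map Subtype.val).getLast? = some y ∧
    c.IsChain (· ⋖ ·) ∧
    (List.zipWith (fun u v : Q => edgeLabel u.1 v.1) c c.tail).IsChain (· ≥ ·)}

/-- The sum `∑ f(π) (2|π₁| - 3)!! ⋯ (2|π_k| - 3)!!` over the partitions `π = π₁ | ⋯ | π_k` of an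
`n`-element set. The convention `(-1)!! = 1` is respected, since `2 * 1 - 3 = 0` and `0‼ = 1`. -/
def chainFormula (n : ℕ) (f : Finpartition (Finset.univ : Finset (Fin n)) → ℕ) : ℕ :=
  ∑ π : Finpartition (Finset.univ : Finset (Fin n)),
    f π * ∏ B ∈ π.parts, (2 * B.card - 3)‼

/-- A rooted tree with node set `V` in which the children of each node are totally ordered: the
list `children v` holds the children of `v` in their order; the root is not a child, every other
node is a child of exactly one node, and every node can be reached from the root. -/
@[ext]
structure OrderedTree (V : Type*) where
  root : V
  children : V → List V
  nodup : ∀ v, (children v).Nodup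
  root_notMem : ∀ v, root ∉ children v
  existsUnique_parent : ∀ w, w ≠ root → ∃! v, w ∈ children v
  reachable : ∀ w, Relation.ReflTransGen (fun a b => b ∈ children a) root w

/-- The increasing ordered trees with nodes `0, 1, …, n`: the labels increase along every path from
the root to a leaf (a path is a list that starts at the root, passes from each node to one of its
children, and ends at a node without children). -/
def increasingOrderedTrees (n : ℕ) : Set (OrderedTree (Fin (n + 1))) :=
  {T | ∀ p : List (Fin (n + 1)), p.head? = some T.root →
    p.IsChain (fun a b => b ∈ T.children a) →
    (∃ l, p.getLast? = some l ∧ T.children l = []) →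
    p.IsChain (· < ·)}

/-! The first claim holds because both sides satisfy `a (n + 1) = (2 * n + 1) * a n`, hence equal
`(2 * n - 1)‼`. For partitions with `k` blocks, a new element forms a block of its own, which
multiplies the weight by `k + 1`, or joins a block of size `b`, which multiplies it by `2 * b - 1`;
since the sizes add up to `n`, these factors sum to `2 * n + 1`
(`Finpartition.sum_factorial_mul_prod_insert`). In an increasing ordered tree the largest label is a
leaf, and it can be put back into any gap of any list of children; there are `∑ (length + 1) = n +
(n + 1)` gaps (`ncard_increasingChildren_succ`).

For the chains, a single sign makes a labeled partition the same thing as the relation "in the same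
block", the signed block being the only block stable under the bar. Let `reps` be the set of
representatives of the unsigned blocks. A cover removes exactly one representative `j`
(`covBy_iff_exists_move`): either its block and the barred block join the signed block, with label
`(1, 1)`, or they are merged with the blocks of a smaller representative `i`, coherently with a
label `(0, _)` or non-coherently with the label `(2, i + 1)`.

A coherent merge cannot occur in a decreasing chain that ends at the full block: all later labels
would start with `0` too, yet a coherent merge always leaves the representative `i`
(`decreasingTails_coherent`). So the word consists of weakly decreasing labels `(2, _)` followed by
labels `(1, 1)`. Suppose that `k` representatives remain and that the labels may use the `r`
smallest. Taking the `s`-th smallest as `i` leaves `k - s` choices of `j`, and exactly the `s`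
smallest may be used next; the moves to the signed block contribute the term `s = 0`. The resulting
recursion (`ncard_decreasingTails_eq`) has the solution `(k + r)! / (r ! * 2 ^ r)` for `r ≤ k`
(`decreasingChainCount_mul`), and `k = r = n` gives `(2 * n - 1)‼`. -/

/-! ### The weighted sum over set partitions -/

namespace Finpartition

variable {α : Type*} [DecidableEq α] {s : Finset α} {a : α}

/-- Add a new element `a` to the block `B` of a partition, or as a new block if `B = ∅`. -/
def insertInto (ha : a ∉ s) (π : Finpartition s) (B : Finset α) (hB : B ∈ insert ∅ π.parts) :
    Finpartition (insert a s) :=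
  Finpartition.ofExistsUnique (insert (insert a B) (π.parts.erase B))
    (by
      have hBs : B ⊆ s := by
        rcases Finset.mem_insert.1 hB with rfl | h
        · exact Finset.empty_subset _
        · exact π.le h
      intro p hp
      rcases Finset.mem_insert.1 hp with rfl | hp
      · exact Finset.insert_subset_insert _ hBs
      · exact (π.le (Finset.mem_of_mem_erase hp)).trans (Finset.subset_insert _ _))
    (by
      intro b hb
      rcases Finset.mem_insert.1 hb with rfl | hb
      · refine ⟨insert b B, ⟨Finset.mem_insert_self _ _, Finset.mem_insert_self _ _⟩, ?_⟩
        rintro t ⟨ht, hbt⟩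
        rcases Finset.mem_insert.1 ht with rfl | ht
        · rfl
        · exact absurd (π.le (Finset.mem_of_mem_erase ht) hbt) ha
      · have hba : b ≠ a := fun h => ha (h ▸ hb)
        obtain ⟨t, ht, hbt⟩ := π.exists_mem hb
        by_cases htB : t = B
        · subst htB
          refine ⟨insert a t, ⟨Finset.mem_insert_self _ _, Finset.mem_insert_of_mem hbt⟩, ?_⟩
          rintro u ⟨hu, hbu⟩
          rcases Finset.mem_insert.1 hu with rfl | hu
          · rfl
          · exact absurd (π.eq_of_mem_parts (Finset.mem_of_mem_erase hu) ht hbu hbt)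
              (Finset.ne_of_mem_erase hu)
        · refine ⟨t, ⟨Finset.mem_insert_of_mem (Finset.mem_erase.2 ⟨htB, ht⟩), hbt⟩, ?_⟩
          rintro u ⟨hu, hbu⟩
          rcases Finset.mem_insert.1 hu with rfl | hu
          · have hbB : b ∈ B := (Finset.mem_insert.1 hbu).resolve_left hba
            rcases Finset.mem_insert.1 hB with rfl | h
            · simp at hbB
            · exact absurd (π.eq_of_mem_parts ht h hbt hbB) htB
          · exact π.eq_of_mem_parts (Finset.mem_of_mem_erase hu) ht hbu hbt)
    (by
      intro h
      rcases Finset.mem_insert.1 h with h | h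
      · exact (Finset.insert_ne_empty _ _) h.symm
      · exact π.empty_notMem_parts (Finset.mem_of_mem_erase h))

theorem parts_insertInto (ha : a ∉ s) (π : Finpartition s) (B : Finset α)
    (hB : B ∈ insert ∅ π.parts) :
    (π.insertInto ha B hB).parts = insert (insert a B) (π.parts.erase B) := rfl

/-- The only block that contains `a` is `insert a B`, so it determines `B`; the other blocks are
those of `π` apart from `B`, and `B` itself is a block of `π` exactly when it is nonempty. -/
theorem insertInto_injective (ha : a ∉ s) {π π' : Finpartition s} {B B' : Finset α}
    {hB : B ∈ insert ∅ π.parts} {hB' : B' ∈ insert ∅ π'.parts}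
    (h : π.insertInto ha B hB = π'.insertInto ha B' hB') : π = π' ∧ B = B' := by
  have hmem : ∀ {ρ : Finpartition s} {C : Finset α}, C ∈ insert ∅ ρ.parts → a ∉ C := by
    intro ρ C hC haC
    rcases Finset.mem_insert.1 hC with rfl | h
    · simp at haC
    · exact ha (ρ.le h haC)
  have hp := congrArg Finpartition.parts h
  rw [parts_insertInto, parts_insertInto] at hp
  have hBB : B = B' := by
    have h1 : insert a B ∈ insert (insert a B') (π'.parts.erase B') :=
      hp ▸ Finset.mem_insert_self _ _
    rcases Finset.mem_insert.1 h1 with h1 | h1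
    · rw [← Finset.erase_insert (hmem hB), h1, Finset.erase_insert (hmem hB')]
    · exact absurd (Finset.mem_insert_self a B)
        (hmem (Finset.mem_insert_of_mem (Finset.mem_of_mem_erase h1)))
  subst hBB
  refine ⟨?_, rfl⟩
  have he : π.parts.erase B = π'.parts.erase B := by
    have hn : ∀ {ρ : Finpartition s}, insert a B ∉ ρ.parts.erase B := fun {ρ} h =>
      hmem (Finset.mem_insert_of_mem (Finset.mem_of_mem_erase h)) (Finset.mem_insert_self a B)
    rw [← Finset.erase_insert (hn (ρ := π)), hp, Finset.erase_insert (hn (ρ := π'))]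
  have hsub : ∀ {ρ ρ' : Finpartition s}, ρ.parts.erase B = ρ'.parts.erase B →
      B ∈ insert ∅ ρ'.parts → ρ.parts ⊆ ρ'.parts := by
    intro ρ ρ' hρ hB C hC
    by_cases hCB : C = B
    · subst hCB
      exact (Finset.mem_insert.1 hB).resolve_left (ρ.ne_empty hC)
    · exact Finset.mem_of_mem_erase (hρ ▸ Finset.mem_erase.2 ⟨hCB, hC⟩)
  exact Finpartition.ext (Finset.Subset.antisymm (hsub he hB') (hsub he.symm hB))

theorem exists_insertInto_eq (ha : a ∉ s) (ψ : Finpartition (insert a s)) :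
    ∃ (π : Finpartition s) (B : Finset α) (hB : B ∈ insert ∅ π.parts),
      π.insertInto ha B hB = ψ := by
  have haψ : a ∈ ψ.part a := ψ.mem_part_self.2 (Finset.mem_insert_self _ _)
  have hPψ : ψ.part a ∈ ψ.parts := ψ.part_mem.2 (Finset.mem_insert_self _ _)
  have hnot : ∀ C ∈ ψ.parts, C ≠ ψ.part a → a ∉ C := fun C hC hne haC =>
    hne (ψ.part_eq_of_mem hC haC).symm
  have hmem : ∀ C, C ∈ (insert ((ψ.part a).erase a) (ψ.parts.erase (ψ.part a))).erase ∅ ↔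
      C ≠ ∅ ∧ (C = (ψ.part a).erase a ∨ (C ≠ ψ.part a ∧ C ∈ ψ.parts)) := by
    intro C
    simp only [Finset.mem_erase, Finset.mem_insert]
  -- Delete `a` from its block; erasing `∅` covers the case where `{a}` was a block.
  let π : Finpartition s := Finpartition.ofExistsUnique
    ((insert ((ψ.part a).erase a) (ψ.parts.erase (ψ.part a))).erase ∅)
    (by
      intro C hC b hb
      obtain ⟨-, rfl | ⟨hne, hC⟩⟩ := (hmem C).1 hC
      · obtain ⟨hba, hb⟩ := Finset.mem_erase.1 hb
        exact (Finset.mem_insert.1 (ψ.le hPψ hb)).resolve_left hba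
      · refine (Finset.mem_insert.1 (ψ.le hC hb)).resolve_left ?_
        rintro rfl
        exact hnot C hC hne hb)
    (by
      intro b hb
      have hba : b ≠ a := fun h => ha (h ▸ hb)
      obtain ⟨t, ht, hbt⟩ := ψ.exists_mem (Finset.mem_insert_of_mem (b := a) hb)
      by_cases htP : t = ψ.part a
      · have hbP : b ∈ (ψ.part a).erase a := Finset.mem_erase.2 ⟨hba, htP ▸ hbt⟩
        refine ⟨(ψ.part a).erase a, ⟨(hmem _).2 ⟨Finset.ne_empty_of_mem hbP, Or.inl rfl⟩, hbP⟩, ?_⟩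
        rintro u ⟨hu, hbu⟩
        obtain ⟨-, h | ⟨hne, hu⟩⟩ := (hmem u).1 hu
        · exact h
        · exact absurd (ψ.eq_of_mem_parts hu hPψ hbu (htP ▸ hbt)) hne
      · refine ⟨t, ⟨(hmem _).2 ⟨ψ.ne_empty ht, Or.inr ⟨htP, ht⟩⟩, hbt⟩, ?_⟩
        rintro u ⟨hu, hbu⟩
        obtain ⟨-, rfl | ⟨hne, hu⟩⟩ := (hmem u).1 hu
        · exact absurd (ψ.eq_of_mem_parts ht hPψ hbt (Finset.mem_of_mem_erase hbu)) htP
        · exact ψ.eq_of_mem_parts hu ht hbu hbt)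
    (Finset.notMem_erase _ _)
  have hπ : ∀ C, C ∈ π.parts ↔
      C ≠ ∅ ∧ (C = (ψ.part a).erase a ∨ (C ≠ ψ.part a ∧ C ∈ ψ.parts)) := hmem
  have hB : (ψ.part a).erase a ∈ insert ∅ π.parts := by
    by_cases h : (ψ.part a).erase a = ∅
    · rw [h]; exact Finset.mem_insert_self _ _
    · exact Finset.mem_insert_of_mem ((hπ _).2 ⟨h, Or.inl rfl⟩)
  refine ⟨π, (ψ.part a).erase a, hB, Finpartition.ext ?_⟩
  rw [parts_insertInto, Finset.insert_erase haψ]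
  ext C
  rw [Finset.mem_insert, Finset.mem_erase, hπ]
  constructor
  · rintro (rfl | ⟨hne, -, h | h⟩)
    · exact hPψ
    · exact absurd h hne
    · exact h.2
  · intro hC
    by_cases h : C = ψ.part a
    · exact Or.inl h
    · refine Or.inr ⟨?_, ψ.ne_empty hC, Or.inr ⟨h, hC⟩⟩
      rintro rfl
      obtain ⟨b, hb⟩ := ψ.nonempty_of_mem_parts hC
      exact h (ψ.eq_of_mem_parts hC hPψ hb (Finset.mem_of_mem_erase hb))

theorem sum_finpartition_insert {M : Type*} [AddCommMonoid M] (ha : a ∉ s)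
    (f : Finpartition (insert a s) → M) :
    ∑ ψ, f ψ = ∑ π : Finpartition s, ∑ B ∈ (insert ∅ π.parts).attach,
      f (π.insertInto ha B.1 B.2) := by
  rw [Finset.sum_sigma']
  symm
  refine Finset.sum_bij (fun p _ => p.1.insertInto ha p.2.1 p.2.2) (fun _ _ => Finset.mem_univ _)
    ?_ ?_ (fun _ _ => rfl)
  · rintro ⟨π, B, hB⟩ - ⟨π', B', hB'⟩ - h
    obtain ⟨h1, h2⟩ := insertInto_injective ha h
    dsimp only at h1 h2
    subst h1 h2
    rfl
  · intro ψ _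
    obtain ⟨π, B, hB, h⟩ := exists_insertInto_eq ha ψ
    exact ⟨⟨π, B, hB⟩, Finset.mem_sigma.2 ⟨Finset.mem_univ _, Finset.mem_attach _ _⟩, h⟩

theorem sum_factorial_mul_prod_insert (ha : a ∉ s) :
    ∑ ψ : Finpartition (insert a s), (ψ.parts.card)! * ∏ B ∈ ψ.parts, (2 * B.card - 3)‼ =
      (2 * s.card + 1) *
        ∑ π : Finpartition s, (π.parts.card)! * ∏ B ∈ π.parts, (2 * B.card - 3)‼ := by
  rw [sum_finpartition_insert ha, Finset.mul_sum]
  refine Finset.sum_congr rfl fun π _ => ?_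
  have hmem : ∀ {C : Finset α}, C ∈ insert ∅ π.parts → a ∉ C := by
    intro C hC haC
    rcases Finset.mem_insert.1 hC with rfl | h
    · simp at haC
    · exact ha (π.le h haC)
  have hn : ∀ {B : Finset α}, insert a B ∉ π.parts.erase B := fun {B} h =>
    hmem (Finset.mem_insert_of_mem (Finset.mem_of_mem_erase h)) (Finset.mem_insert_self a B)
  have key : ∀ B ∈ insert ∅ π.parts,
      ((insert (insert a B) (π.parts.erase B)).card)! *
        ∏ C ∈ insert (insert a B) (π.parts.erase B), (2 * C.card - 3)‼ =
      (if B = ∅ then π.parts.card + 1 else 2 * B.card - 1) *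
        ((π.parts.card)! * ∏ B ∈ π.parts, (2 * B.card - 3)‼) := by
    intro B hB
    rw [Finset.card_insert_of_notMem hn, Finset.prod_insert hn,
      Finset.card_insert_of_notMem (hmem hB)]
    rcases Finset.mem_insert.1 hB with rfl | h
    · rw [Finset.erase_eq_of_notMem π.empty_notMem_parts]
      simp [Nat.factorial_succ, mul_assoc]
    · rw [if_neg (π.ne_empty h), Finset.card_erase_add_one h, ← Finset.mul_prod_erase _ _ h]
      have hpos : 0 < B.card := (π.nonempty_of_mem_parts h).card_pos
      -- For `B.card = 1` the truncated subtraction gives `0‼ = 1`, which plays the role of `(-1)‼`.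
      have hw : (2 * (B.card + 1) - 3)‼ = (2 * B.card - 1) * (2 * B.card - 3)‼ := by
        obtain ⟨m, hm⟩ : ∃ m, B.card = m + 1 := ⟨B.card - 1, by omega⟩
        rw [hm, show 2 * (m + 1 + 1) - 3 = 2 * m + 1 by omega, Nat.doubleFactorial_add_one,
          show 2 * (m + 1) - 1 = 2 * m + 1 by omega, show 2 * (m + 1) - 3 = 2 * m - 1 by omega]
      rw [hw]
      ring
  simp only [parts_insertInto]
  rw [Finset.sum_attach (insert ∅ π.parts) (fun B =>
    ((insert (insert a B) (π.parts.erase B)).card)! *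
        ∏ C ∈ insert (insert a B) (π.parts.erase B), (2 * C.card - 3)‼),
    Finset.sum_congr rfl key, ← Finset.sum_mul, Finset.sum_insert π.empty_notMem_parts, if_pos rfl]
  congr 1
  -- Adding the number of blocks cancels the `- 1` in each summand and avoids subtraction.
  have h1 : ∑ B ∈ π.parts, (if B = ∅ then π.parts.card + 1 else 2 * B.card - 1) + π.parts.card =
      2 * s.card := by
    rw [Finset.card_eq_sum_ones, ← Finset.sum_add_distrib, ← π.sum_card_parts, Finset.mul_sum]
    refine Finset.sum_congr rfl fun B hB => ?_
    have := (π.nonempty_of_mem_parts hB).card_pos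
    rw [if_neg (π.ne_empty hB)]
    omega
  omega

theorem sum_factorial_mul_prod (s : Finset α) :
    ∑ π : Finpartition s, (π.parts.card)! * ∏ B ∈ π.parts, (2 * B.card - 3)‼ =
      (2 * s.card - 1)‼ := by
  induction s using Finset.induction_on with
  | empty =>
    have : ∀ π : Finpartition (∅ : Finset α), π.parts = ∅ := fun π => by
      simp
    have hu : (Finset.univ : Finset (Finpartition (∅ : Finset α))) = {⊥} := by
      ext π
      simp only [Finset.mem_univ, Finset.mem_singleton, true_iff]
      exact Finpartition.ext ((this _).trans (this _).symm)
    rw [hu, Finset.sum_singleton, this]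
    simp
  | insert a s ha ih =>
    rw [sum_factorial_mul_prod_insert ha, ih, Finset.card_insert_of_notMem ha,
      show 2 * (s.card + 1) - 1 = 2 * s.card + 1 by omega, Nat.doubleFactorial_add_one]

end Finpartition

theorem chainFormula_factorial (n : ℕ) :
    chainFormula n (fun π => (π.parts.card)!) = (2 * n - 1)‼ := by
  simp [chainFormula, Finpartition.sum_factorial_mul_prod]

/-! ### Counting increasing trees by inserting the largest label -/

/-- The children functions of the increasing ordered trees with nodes `0, 1, …, n` and root `0`,
extended by the empty list to all natural numbers. -/
def increasingChildren (n : ℕ) : Set (ℕ → List ℕ) :=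
  {c | (∀ v, (c v).Nodup) ∧ (∀ v, ∀ w ∈ c v, v < w ∧ w ≤ n) ∧
    (∀ v v' w, w ∈ c v → w ∈ c v' → v = v') ∧ ∀ w, 1 ≤ w → w ≤ n → ∃ v, w ∈ c v}

theorem sum_length_of_mem_increasingChildren {n : ℕ} {c : ℕ → List ℕ}
    (hc : c ∈ increasingChildren n) : ∑ v ∈ Finset.range (n + 1), (c v).length = n := by
  obtain ⟨h1, h2, h3, h4⟩ := hc
  have hb : (Finset.range (n + 1)).biUnion (fun v => (c v).toFinset) = Finset.Icc 1 n := by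
    ext w
    simp only [Finset.mem_biUnion, Finset.mem_range, List.mem_toFinset, Finset.mem_Icc]
    constructor
    · rintro ⟨v, -, hw⟩
      have := h2 v w hw
      omega
    · rintro ⟨hw1, hw⟩
      obtain ⟨v, hv⟩ := h4 w hw1 hw
      have := h2 v w hv
      exact ⟨v, by omega, hv⟩
  have hcard := Finset.card_biUnion (s := Finset.range (n + 1)) (t := fun v => (c v).toFinset)
    (fun v _ v' _ hne => Finset.disjoint_left.2 fun w hw hw' =>
      hne (h3 v v' w (List.mem_toFinset.1 hw) (List.mem_toFinset.1 hw')))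
  rw [hb, Nat.card_Icc] at hcard
  rw [Finset.sum_congr rfl fun v _ => (List.toFinset_card_of_nodup (h1 v)).symm, ← hcard]
  omega

theorem update_insertIdx_mem_increasingChildren {n : ℕ} {c : ℕ → List ℕ}
    (hc : c ∈ increasingChildren n) {v p : ℕ} (hv : v ≤ n) (hp : p ≤ (c v).length) :
    Function.update c v ((c v).insertIdx p (n + 1)) ∈ increasingChildren (n + 1) := by
  obtain ⟨h1, h2, h3, h4⟩ := hc
  have hmem : ∀ u w, w ∈ Function.update c v ((c v).insertIdx p (n + 1)) u ↔
      (u = v ∧ w = n + 1) ∨ w ∈ c u := by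
    intro u w
    by_cases huv : u = v
    · subst huv
      simp [List.mem_insertIdx hp]
    · simp [huv]
  have hnot : ∀ u, n + 1 ∉ c u := fun u h => by
    have := h2 u _ h
    omega
  refine ⟨fun u => ?_, fun u w hw => ?_, fun u u' w hw hw' => ?_, fun w hw1 hw => ?_⟩
  · by_cases huv : u = v
    · subst huv
      rw [Function.update_self, (List.perm_insertIdx _ _ hp).nodup_iff, List.nodup_cons]
      exact ⟨hnot u, h1 u⟩
    · rw [Function.update_of_ne huv]
      exact h1 u
  · rcases (hmem u w).1 hw with ⟨rfl, rfl⟩ | hw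
    · omega
    · have := h2 u w hw
      omega
  · rcases (hmem u w).1 hw with ⟨rfl, rfl⟩ | hu
    · rcases (hmem u' _).1 hw' with ⟨rfl, -⟩ | hu'
      · rfl
      · exact absurd hu' (hnot _)
    · rcases (hmem u' _).1 hw' with ⟨-, rfl⟩ | hu'
      · exact absurd hu (hnot _)
      · exact h3 u u' w hu hu'
  · by_cases h : w = n + 1
    · exact ⟨v, (hmem v w).2 (Or.inl ⟨rfl, h⟩)⟩
    · obtain ⟨u, hu⟩ := h4 w hw1 (by omega)
      exact ⟨u, (hmem u w).2 (Or.inr hu)⟩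

/-- Children exceed their parents, so the largest label `n + 1` is a leaf; erase it from its
parent's list and remember its index. -/
theorem exists_update_insertIdx_eq {n : ℕ} {c : ℕ → List ℕ} (hc : c ∈ increasingChildren (n + 1)) :
    ∃ d ∈ increasingChildren n, ∃ v ≤ n, ∃ p ≤ (d v).length,
      Function.update d v ((d v).insertIdx p (n + 1)) = c := by
  obtain ⟨h1, h2, h3, h4⟩ := hc
  obtain ⟨v, hv⟩ := h4 (n + 1) (by omega) le_rfl
  have hvn := h2 v _ hv
  have hlt : (c v).idxOf (n + 1) < (c v).length := List.idxOf_lt_length_of_mem hv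
  have hmem : ∀ u w, w ∈ Function.update c v ((c v).erase (n + 1)) u ↔ w ≠ n + 1 ∧ w ∈ c u := by
    intro u w
    by_cases huv : u = v
    · subst huv
      rw [Function.update_self, (h1 u).mem_erase_iff]
    · rw [Function.update_of_ne huv]
      exact ⟨fun h => ⟨fun hw => huv (h3 u v (n + 1) (hw ▸ h) hv), h⟩, fun h => h.2⟩
  refine ⟨Function.update c v ((c v).erase (n + 1)), ⟨fun u => ?_, fun u w hw => ?_,
    fun u u' w hw hw' => ?_, fun w hw1 hw => ?_⟩, v, by omega, (c v).idxOf (n + 1), ?_, ?_⟩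
  · by_cases huv : u = v
    · subst huv
      rw [Function.update_self]
      exact (h1 u).erase _
    · rw [Function.update_of_ne huv]
      exact h1 u
  · obtain ⟨hne, hw⟩ := (hmem u w).1 hw
    have := h2 u w hw
    omega
  · exact h3 u u' w ((hmem _ _).1 hw).2 ((hmem _ _).1 hw').2
  · obtain ⟨u, hu⟩ := h4 w hw1 (by omega)
    exact ⟨u, (hmem u w).2 ⟨by omega, hu⟩⟩
  · rw [Function.update_self, List.length_erase_of_mem hv]
    omega
  · rw [Function.update_self, Function.update_idem, Function.update_eq_self_iff,
      List.erase_eq_eraseIdx_of_idxOf rfl]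
    conv_rhs => rw [← List.insertIdx_eraseIdx_getElem hlt]
    rw [List.getElem_idxOf]

/-- The label `n + 1` is new, so its position in the result reveals both the parent and the index,
and erasing it recovers the old list. -/
theorem update_insertIdx_injective {n : ℕ} {c c' : ℕ → List ℕ} (hc : c ∈ increasingChildren n)
    (hc' : c' ∈ increasingChildren n) {v p v' p' : ℕ} (hp : p ≤ (c v).length)
    (hp' : p' ≤ (c' v').length)
    (h : Function.update c v ((c v).insertIdx p (n + 1)) =
      Function.update c' v' ((c' v').insertIdx p' (n + 1))) : c = c' ∧ v = v' ∧ p = p' := by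
  have hnot : ∀ {d}, d ∈ increasingChildren n → ∀ u, n + 1 ∉ d u := fun hd u h => by
    have := hd.2.1 u _ h
    omega
  have hv : v = v' := by
    by_contra hne
    have h1 := congrFun h v
    rw [Function.update_self, Function.update_of_ne hne] at h1
    exact hnot hc' v (h1 ▸ (List.mem_insertIdx hp).2 (Or.inl rfl))
  subst hv
  have h1 := congrFun h v
  rw [Function.update_self, Function.update_self] at h1
  have herase : ∀ {l : List ℕ} {q : ℕ}, n + 1 ∉ l → q ≤ l.length →
      (l.insertIdx q (n + 1)).erase (n + 1) = l := by
    intro l q hl hq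
    induction l generalizing q with
    | nil => obtain rfl : q = 0 := by simpa using hq
             simp
    | cons b l ih =>
      rw [List.mem_cons, not_or] at hl
      cases q with
      | zero => simp
      | succ q =>
        rw [List.insertIdx_succ_cons, List.erase_cons_tail (by simpa using Ne.symm hl.1),
          ih hl.2 (by simpa using hq)]
  have h2 : c v = c' v := by
    rw [← herase (hnot hc v) hp, h1, herase (hnot hc' v) hp']
  refine ⟨funext fun u => ?_, rfl, ?_⟩
  · by_cases hu : u = v
    · rw [hu, h2]
    · have h3 := congrFun h u
      rwa [Function.update_of_ne hu, Function.update_of_ne hu] at h3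
  · rw [← h2] at h1
    exact List.injOn_insertIdx_index_of_notMem _ _ (hnot hc v) hp (by rw [← h2] at hp'; exact hp') h1

/-- A list of length `l` has `l + 1` gaps. The `n + 1` lists have total length `n`, so the number of
gaps is `2 * n + 1` whatever the tree is. -/
theorem ncard_increasingChildren_succ (n : ℕ) :
    (increasingChildren (n + 1)).ncard = (2 * n + 1) * (increasingChildren n).ncard := by
  let f : (Σ c : increasingChildren n, Σ v : Fin (n + 1), Fin ((c.1 v).length + 1)) →
      increasingChildren (n + 1) := fun x =>
    ⟨_, update_insertIdx_mem_increasingChildren x.1.2 (Nat.lt_succ_iff.1 x.2.1.2)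
      (Nat.lt_succ_iff.1 x.2.2.2)⟩
  have hf : Function.Bijective f := by
    constructor
    · rintro ⟨⟨c, hc⟩, ⟨v, hv⟩, ⟨p, hp⟩⟩ ⟨⟨c', hc'⟩, ⟨v', hv'⟩, ⟨p', hp'⟩⟩ h
      obtain ⟨rfl, rfl, rfl⟩ := update_insertIdx_injective hc hc' (Nat.lt_succ_iff.1 hp)
        (Nat.lt_succ_iff.1 hp') (congrArg Subtype.val h)
      rfl
    · rintro ⟨c, hc⟩
      obtain ⟨d, hd, v, hv, p, hp, h⟩ := exists_update_insertIdx_eq hc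
      exact ⟨⟨⟨d, hd⟩, ⟨v, Nat.lt_succ_iff.2 hv⟩, ⟨p, Nat.lt_succ_iff.2 hp⟩⟩, Subtype.ext h⟩
  have he : ∀ c : increasingChildren n,
      Nonempty ((Σ v : Fin (n + 1), Fin ((c.1 v).length + 1)) ≃ Fin (2 * n + 1)) := by
    intro c
    refine ⟨Fintype.equivFinOfCardEq ?_⟩
    rw [Fintype.card_sigma]
    simp only [Fintype.card_fin]
    rw [Finset.sum_add_distrib, Fin.sum_univ_eq_sum_range (fun v => (c.1 v).length),
      sum_length_of_mem_increasingChildren c.2]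
    simp
    omega
  rw [← Nat.card_coe_set_eq, ← Nat.card_coe_set_eq, ← Nat.card_congr (Equiv.ofBijective f hf),
    Nat.card_congr ((Equiv.sigmaCongrRight fun c => (he c).some).trans (Equiv.sigmaEquivProd _ _)),
    Nat.card_prod, Nat.card_fin, mul_comm]

theorem ncard_increasingChildren (n : ℕ) : (increasingChildren n).ncard = (2 * n - 1)‼ := by
  induction n with
  | zero =>
    have : increasingChildren 0 = {fun _ => []} := by
      ext c
      simp only [Set.mem_singleton_iff]
      constructor
      · intro hc
        funext v
        refine List.eq_nil_iff_forall_not_mem.2 fun w hw => ?_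
        have := hc.2.1 v w hw
        omega
      · rintro rfl
        exact ⟨by simp, by simp, by simp, fun w h1 h0 => by omega⟩
    simp [this]
  | succ n ih =>
    rw [ncard_increasingChildren_succ, ih, show 2 * (n + 1) - 1 = 2 * n + 1 by omega,
      Nat.doubleFactorial_add_one]

/-! ### Increasing ordered trees as children functions -/

namespace OrderedTree

variable {V : Type*} (T : OrderedTree V)

/-- A cycle through a node enters it from its unique parent, so it also passes through the parent;
going up one reaches the root, which nothing enters. -/
theorem not_transGen_self (v : V) : ¬ Relation.TransGen (fun a b => b ∈ T.children a) v v := by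
  induction T.reachable v with
  | refl =>
    intro h
    obtain ⟨u, -, hu⟩ := Relation.TransGen.tail'_iff.1 h
    exact T.root_notMem u hu
  | @tail b w _ hbw ih =>
    intro h
    obtain ⟨u, hwu, hu⟩ := Relation.TransGen.tail'_iff.1 h
    have hw : w ≠ T.root := fun h => T.root_notMem u (h ▸ hu)
    obtain rfl : u = b := (T.existsUnique_parent w hw).unique hu hbw
    exact ih (Relation.TransGen.head' hbw hwu)

theorem exists_reachable_leaf [Finite V] (v : V) :
    ∃ l, Relation.ReflTransGen (fun a b => b ∈ T.children a) v l ∧ T.children l = [] := by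
  let r : V → V → Prop := fun a b => Relation.TransGen (fun a b => b ∈ T.children a) b a
  have : IsTrans V r := ⟨fun a b c h h' => Relation.TransGen.trans h' h⟩
  have : Std.Irrefl r := ⟨fun a => T.not_transGen_self a⟩
  have hwf : WellFounded r := Finite.wellFounded_of_trans_of_irrefl r
  induction v using hwf.induction with
  | _ v ih =>
    by_cases hv : T.children v = []
    · exact ⟨v, Relation.ReflTransGen.refl, hv⟩
    · obtain ⟨w, hw⟩ := List.exists_mem_of_ne_nil _ hv
      obtain ⟨l, hl, hl'⟩ := ih w (Relation.TransGen.single hw)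
      exact ⟨l, Relation.ReflTransGen.head hw hl, hl'⟩

/-- Every edge lies on a path from the root to a leaf: join a path from the root to its source with
a path from its target to a leaf. -/
theorem mem_increasingOrderedTrees_iff {n : ℕ} (T : OrderedTree (Fin (n + 1))) :
    T ∈ increasingOrderedTrees n ↔ ∀ v, ∀ w ∈ T.children v, v < w := by
  constructor
  · intro hT v w hvw
    obtain ⟨p, hp, hpv⟩ := List.exists_isChain_cons_of_relationReflTransGen (T.reachable v)
    obtain ⟨l, hwl, hl⟩ := T.exists_reachable_leaf w
    obtain ⟨q, hq, hql⟩ := List.exists_isChain_cons_of_relationReflTransGen hwl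
    have hchain : List.IsChain (fun a b => b ∈ T.children a) ((T.root :: p) ++ (w :: q)) := by
      rw [List.isChain_append]
      refine ⟨hp, hq, fun a ha b hb => ?_⟩
      rw [List.getLast?_eq_getLast_of_ne_nil (List.cons_ne_nil _ _), hpv] at ha
      simp only [Option.mem_def, Option.some.injEq, List.head?_cons] at ha hb
      rwa [← ha, ← hb]
    have hinc := hT _ (by simp) hchain ⟨l, by
      rw [List.getLast?_append_of_ne_nil _ (List.cons_ne_nil _ _),
        List.getLast?_eq_getLast_of_ne_nil (List.cons_ne_nil _ _), hql], hl⟩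
    rw [List.isChain_append] at hinc
    exact hinc.2.2 v (by
      rw [List.getLast?_eq_getLast_of_ne_nil (List.cons_ne_nil _ _), hpv]; rfl) w (by simp)
  · intro hT p _ hp _
    exact hp.imp fun a b => hT a b

theorem root_eq_zero {n : ℕ} {T : OrderedTree (Fin (n + 1))}
    (hT : T ∈ increasingOrderedTrees n) : T.root = 0 := by
  by_contra h
  obtain ⟨v, hv, -⟩ := T.existsUnique_parent 0 (Ne.symm h)
  exact absurd ((mem_increasingOrderedTrees_iff T).1 hT v 0 hv) (Fin.not_lt_zero v)

/-- The children of the nodes `0, …, n`, as a function on all natural numbers. -/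
def natChildren {n : ℕ} (T : OrderedTree (Fin (n + 1))) (v : ℕ) : List ℕ :=
  if h : v < n + 1 then (T.children ⟨v, h⟩).map Fin.val else []

theorem natChildren_val {n : ℕ} (T : OrderedTree (Fin (n + 1))) (v : Fin (n + 1)) :
    T.natChildren v = (T.children v).map Fin.val := by
  rw [natChildren, dif_pos v.2]

theorem mem_natChildren {n : ℕ} (T : OrderedTree (Fin (n + 1))) {v w : ℕ} :
    w ∈ T.natChildren v ↔ ∃ v' w' : Fin (n + 1), (v' : ℕ) = v ∧ (w' : ℕ) = w ∧
      w' ∈ T.children v' := by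
  constructor
  · intro h
    by_cases hv : v < n + 1
    · simp only [natChildren, hv, dif_pos, List.mem_map] at h
      obtain ⟨w', hw', rfl⟩ := h
      exact ⟨⟨v, hv⟩, w', rfl, rfl, hw'⟩
    · simp [natChildren, hv] at h
  · rintro ⟨v', w', rfl, rfl, h⟩
    rw [natChildren_val]
    exact List.mem_map_of_mem h

theorem natChildren_mem {n : ℕ} {T : OrderedTree (Fin (n + 1))}
    (hT : T ∈ increasingOrderedTrees n) : T.natChildren ∈ increasingChildren n := by
  have hroot := root_eq_zero hT
  rw [mem_increasingOrderedTrees_iff] at hT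
  refine ⟨fun v => ?_, fun v w hw => ?_, fun v v' w hw hw' => ?_, fun w h1 hw => ?_⟩
  · unfold natChildren
    split_ifs with h
    · exact (T.nodup _).map Fin.val_injective
    · exact List.nodup_nil
  · obtain ⟨v, w, rfl, rfl, h⟩ := T.mem_natChildren.1 hw
    exact ⟨hT v w h, by omega⟩
  · obtain ⟨v, w, rfl, rfl, h⟩ := T.mem_natChildren.1 hw
    obtain ⟨v', w', rfl, hww, h'⟩ := T.mem_natChildren.1 hw'
    obtain rfl : w' = w := Fin.ext hww
    have hne : w' ≠ T.root := fun h0 => T.root_notMem v (h0 ▸ h)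
    rw [(T.existsUnique_parent w' hne).unique h h']
  · have hne : (⟨w, by omega⟩ : Fin (n + 1)) ≠ T.root := by
      rw [hroot]
      intro h
      have := congrArg Fin.val h
      simp only [Fin.val_zero] at this
      omega
    obtain ⟨v, hv, -⟩ := T.existsUnique_parent _ hne
    exact ⟨v, T.mem_natChildren.2 ⟨v, _, rfl, rfl, hv⟩⟩

theorem natChildren_injOn (n : ℕ) :
    Set.InjOn (natChildren (n := n)) (increasingOrderedTrees n) := by
  intro T hT T' hT' h
  refine OrderedTree.ext ((root_eq_zero hT).trans (root_eq_zero hT').symm) (funext fun v => ?_)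
  have := congrFun h v
  rw [natChildren_val, natChildren_val] at this
  exact List.map_injective_iff.2 Fin.val_injective this

theorem exists_natChildren_eq {n : ℕ} {c : ℕ → List ℕ} (hc : c ∈ increasingChildren n) :
    ∃ T ∈ increasingOrderedTrees n, natChildren T = c := by
  obtain ⟨h1, h2, h3, h4⟩ := hc
  have hmap : ∀ v, ((c v).map (Fin.ofNat (n + 1))).map Fin.val = c v := by
    intro v
    rw [List.map_map]
    conv_rhs => rw [← List.map_id (c v)]
    refine List.map_congr_left fun w hw => ?_
    have := (h2 v w hw).2
    simp only [Function.comp_apply, Fin.val_ofNat, id]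
    exact Nat.mod_eq_of_lt (by omega)
  have hmem : ∀ (v : ℕ) (w : Fin (n + 1)), w ∈ (c v).map (Fin.ofNat (n + 1)) ↔ (w : ℕ) ∈ c v := by
    intro v w
    conv_rhs => rw [← hmap v]
    rw [List.mem_map_of_injective Fin.val_injective]
  have hpar : ∀ w : Fin (n + 1), w ≠ 0 → ∃ v : Fin (n + 1), (w : ℕ) ∈ c v := by
    intro w hw
    have hw0 : (w : ℕ) ≠ 0 := fun h => hw (Fin.ext h)
    obtain ⟨v, hv⟩ := h4 w (by omega) (by omega)
    have := (h2 v w hv).1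
    exact ⟨⟨v, by omega⟩, hv⟩
  let T : OrderedTree (Fin (n + 1)) :=
    { root := 0
      children := fun v => (c v).map (Fin.ofNat (n + 1))
      nodup := fun v => by
        refine List.Nodup.of_map Fin.val ?_
        rw [hmap]
        exact h1 v
      root_notMem := fun v h => by
        have := (h2 v _ ((hmem v 0).1 h)).1
        simp at this
      existsUnique_parent := fun w hw => by
        obtain ⟨v, hv⟩ := hpar w hw
        exact ⟨v, (hmem v w).2 hv, fun v' hv' => Fin.ext (h3 v' v w ((hmem v' w).1 hv') hv)⟩
      reachable := fun w => by
        induction w using WellFoundedLT.induction with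
        | _ w ih =>
          by_cases hw : w = 0
          · rw [hw]
          · obtain ⟨v, hv⟩ := hpar w hw
            exact (ih v (Fin.lt_def.2 (h2 v w hv).1)).tail ((hmem v w).2 hv) }
  refine ⟨T, (mem_increasingOrderedTrees_iff T).2 fun v w hw => (h2 v w ((hmem v w).1 hw)).1, ?_⟩
  funext v
  by_cases hv : v < n + 1
  · exact (T.natChildren_val ⟨v, hv⟩).trans (hmap v)
  · rw [natChildren, dif_neg hv]
    refine (List.eq_nil_iff_forall_not_mem.2 fun w hw => ?_).symm
    have := h2 v w hw
    omega

end OrderedTree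

theorem ncard_increasingOrderedTrees (n : ℕ) :
    (increasingOrderedTrees n).ncard = (2 * n - 1)‼ := by
  rw [← ncard_increasingChildren, ← (OrderedTree.natChildren_injOn n).ncard_image]
  congr 1
  ext c
  constructor
  · rintro ⟨T, hT, rfl⟩
    exact OrderedTree.natChildren_mem hT
  · exact OrderedTree.exists_natChildren_eq

/-! ### Representatives and normal forms of letters -/

theorem bar_bar {n : ℕ} (a : Letter n) : bar (bar a) = a := by
  simp [bar]

theorem bar_ne {n : ℕ} (a : Letter n) : bar a ≠ a := by
  simp [bar, Prod.ext_iff]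

/-- No letter equals its bar, so for a map that commutes with the bar only the fibre of `none` can
be stable under the bar. This makes `none` a faithful name for the signed block. -/
theorem map_bar_eq_self {n : ℕ} {u : Option (Letter n)} : u.map bar = u ↔ u = none := by
  cases u with
  | none => simp
  | some b => simp [bar_ne]

theorem mem_barSet {n : ℕ} {R : Finset (Letter n)} {a : Letter n} :
    a ∈ barSet R ↔ bar a ∈ R := by
  constructor
  · intro h
    obtain ⟨b, hb, rfl⟩ := Finset.mem_image.1 h
    rwa [bar_bar]
  · intro h
    exact Finset.mem_image.2 ⟨bar a, h, bar_bar a⟩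

namespace LabeledPartition

variable {n : ℕ} {S : Type*}

/-- Two letters lie in the same block of `x`. -/
def Rel (x : LabeledPartition n S) (a b : Letter n) : Prop := x.partition.part a = x.partition.part b

theorem part_mem (x : LabeledPartition n S) (a : Letter n) :
    x.partition.part a ∈ x.partition.parts := x.partition.part_mem.2 (Finset.mem_univ _)

theorem mem_part_self (x : LabeledPartition n S) (a : Letter n) : a ∈ x.partition.part a :=
  x.partition.mem_part_self.2 (Finset.mem_univ _)

theorem exists_eq_part {x : LabeledPartition n S} {R : Finset (Letter n)}
    (hR : R ∈ x.partition.parts) : ∃ a, R = x.partition.part a := by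
  obtain ⟨a, ha⟩ := x.partition.nonempty_of_mem_parts hR
  exact ⟨a, (x.partition.part_eq_of_mem hR ha).symm⟩

theorem mem_part {x : LabeledPartition n S} {a b : Letter n} :
    b ∈ x.partition.part a ↔ x.Rel b a :=
  x.partition.mem_part_iff_part_eq_part (Finset.mem_univ _) (Finset.mem_univ _)

theorem Rel.symm {x : LabeledPartition n S} {a b : Letter n} (h : x.Rel a b) : x.Rel b a :=
  Eq.symm h

theorem Rel.trans {x : LabeledPartition n S} {a b c : Letter n} (h : x.Rel a b)
    (h' : x.Rel b c) : x.Rel a c := Eq.trans h h'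

theorem Rel.refl (x : LabeledPartition n S) (a : Letter n) : x.Rel a a := Eq.refl _

theorem barSet_part (x : LabeledPartition n S) (a : Letter n) :
    barSet (x.partition.part a) = x.partition.part (bar a) :=
  (x.partition.part_eq_of_mem (x.bar_mem _ (x.part_mem a))
    (mem_barSet.2 (by rw [bar_bar]; exact x.mem_part_self a))).symm

theorem Rel.bar {x : LabeledPartition n S} {a b : Letter n} (h : x.Rel a b) :
    x.Rel (bar a) (bar b) := by
  unfold Rel at h ⊢
  rw [← barSet_part, ← barSet_part, h]

/-- The letter `a` lies in a signed block of `x`. -/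
def IsZero (x : LabeledPartition n S) (a : Letter n) : Prop := x.Rel a (bar a)

theorem isZero_iff_sign {x : LabeledPartition n S} {a : Letter n} :
    x.IsZero a ↔ (x.sign (x.partition.part a)).isSome := by
  rw [x.signed_iff, barSet_part]
  exact ⟨fun h => ⟨x.part_mem a, Eq.symm h⟩, fun h => Eq.symm h.2⟩

theorem IsZero.of_rel {x : LabeledPartition n S} {a b : Letter n} (ha : x.IsZero a)
    (h : x.Rel a b) : x.IsZero b := h.symm.trans (Rel.trans ha h.bar)

theorem IsZero.bar {x : LabeledPartition n S} {a : Letter n} (ha : x.IsZero a) :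
    x.IsZero (bar a) := ha.of_rel ha

theorem isZero_iff_fst {x : LabeledPartition n S} {a b : Letter n} (h : a.1 = b.1) :
    x.IsZero a ↔ x.IsZero b := by
  have : a = b ∨ a = _root_.bar b := by
    obtain ⟨i, c⟩ := a
    obtain ⟨j, d⟩ := b
    cases h
    cases c <;> cases d <;> simp [_root_.bar]
  rcases this with rfl | rfl
  · rfl
  · exact ⟨fun h => by simpa [bar_bar] using h.bar, IsZero.bar⟩

open scoped Classical in
/-- The representatives of the unsigned blocks. -/
noncomputable def reps (x : LabeledPartition n S) : Finset (Fin n) :=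
  Finset.univ.filter fun i => ¬ x.IsZero (i, false) ∧ ∀ j < i, ∀ c, ¬ x.Rel (j, c) (i, false)

theorem mem_reps {x : LabeledPartition n S} {i : Fin n} :
    i ∈ x.reps ↔ ¬ x.IsZero (i, false) ∧ ∀ j < i, ∀ c, ¬ x.Rel (j, c) (i, false) := by
  simp [reps]

/-- `u` is the normal form of `a`: `none` if `a` lies in the signed block, and otherwise the letter
of the block of `a` which is a representative or the bar of a representative. -/
def IsKey (x : LabeledPartition n S) (a : Letter n) : Option (Letter n) → Prop
  | none => x.IsZero a
  | some b => b.1 ∈ x.reps ∧ x.Rel a b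

theorem not_isZero_of_mem_reps {x : LabeledPartition n S} {b : Letter n} (hb : b.1 ∈ x.reps) :
    ¬ x.IsZero b := fun h =>
  (mem_reps.1 hb).1 ((isZero_iff_fst (a := b) (b := (b.1, false)) rfl).1 h)

theorem le_of_rel_of_mem_reps {x : LabeledPartition n S} {a b : Letter n} (hb : b.1 ∈ x.reps)
    (h : x.Rel a b) : b.1 ≤ a.1 := by
  by_contra hlt
  rw [not_le] at hlt
  obtain ⟨i, c⟩ := b
  cases c with
  | false => exact (mem_reps.1 hb).2 a.1 hlt a.2 h
  | true => exact (mem_reps.1 hb).2 a.1 hlt (!a.2) h.bar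

theorem eq_of_rel_of_mem_reps {x : LabeledPartition n S} {a b : Letter n} (ha : a.1 ∈ x.reps)
    (hb : b.1 ∈ x.reps) (h : x.Rel a b) : a = b := by
  have h1 : a.1 = b.1 :=
    le_antisymm (le_of_rel_of_mem_reps ha h.symm) (le_of_rel_of_mem_reps hb h)
  by_contra hne
  have h2 : b = bar a := by
    obtain ⟨i, c⟩ := a
    obtain ⟨j, d⟩ := b
    cases h1
    cases c <;> cases d <;> simp_all [_root_.bar]
  subst h2
  exact not_isZero_of_mem_reps ha h

theorem exists_isKey (x : LabeledPartition n S) (a : Letter n) : ∃ u, x.IsKey a u := by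
  classical
  by_cases hz : x.IsZero a
  · exact ⟨none, hz⟩
  · have hne : (Finset.univ.filter fun i : Fin n => ∃ c, x.Rel (i, c) a).Nonempty :=
      ⟨a.1, Finset.mem_filter.2 ⟨Finset.mem_univ _, a.2, Rel.refl x a⟩⟩
    obtain ⟨i, hi, hmin⟩ := Finset.exists_min_image _ id hne
    obtain ⟨c, hc⟩ := (Finset.mem_filter.1 hi).2
    refine ⟨some (i, c), mem_reps.2 ⟨fun h => hz ?_, fun j hj d hd => ?_⟩, hc.symm⟩
    · exact ((isZero_iff_fst (a := (i, false)) (b := (i, c)) rfl).1 h).of_rel hc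
    · have hj' : ∃ e, x.Rel (j, e) (i, c) := by
        cases c with
        | false => exact ⟨d, hd⟩
        | true => exact ⟨!d, hd.bar⟩
      obtain ⟨e, he⟩ := hj'
      exact absurd (hmin j (Finset.mem_filter.2 ⟨Finset.mem_univ _, e, he.trans hc⟩))
        (not_le.2 hj)

/-- The normal form of `a`. -/
noncomputable def key (x : LabeledPartition n S) (a : Letter n) : Option (Letter n) :=
  (x.exists_isKey a).choose

theorem isKey_key (x : LabeledPartition n S) (a : Letter n) : x.IsKey a (x.key a) :=
  (x.exists_isKey a).choose_spec

theorem IsKey.unique {x : LabeledPartition n S} {a b : Letter n} {u v : Option (Letter n)}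
    (hu : x.IsKey a u) (hv : x.IsKey b v) (h : x.Rel a b) : u = v := by
  rcases u with _ | u <;> rcases v with _ | v
  · rfl
  · exact absurd ((IsZero.of_rel hu h).of_rel hv.2) (not_isZero_of_mem_reps hv.1)
  · exact absurd ((IsZero.of_rel hv h.symm).of_rel hu.2) (not_isZero_of_mem_reps hu.1)
  · exact congrArg some (eq_of_rel_of_mem_reps hu.1 hv.1 (hu.2.symm.trans (h.trans hv.2)))

theorem IsKey.key_eq {x : LabeledPartition n S} {a : Letter n} {u : Option (Letter n)}
    (hu : x.IsKey a u) : x.key a = u := (x.isKey_key a).unique hu (Rel.refl x a)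

theorem key_eq_none_iff {x : LabeledPartition n S} {a : Letter n} :
    x.key a = none ↔ x.IsZero a :=
  ⟨fun h => by have := x.isKey_key a; rwa [h] at this, fun h => IsKey.key_eq (u := none) h⟩

theorem key_bar (x : LabeledPartition n S) (a : Letter n) : x.key (bar a) = (x.key a).map bar := by
  have ha := x.isKey_key a
  refine IsKey.key_eq ?_
  rcases hk : x.key a with _ | u
  · rw [hk] at ha
    exact IsZero.bar ha
  · rw [hk] at ha
    exact ⟨ha.1, ha.2.bar⟩

theorem key_of_mem_reps {x : LabeledPartition n S} {b : Letter n} (hb : b.1 ∈ x.reps) :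
    x.key b = some b := IsKey.key_eq (u := some b) ⟨hb, Rel.refl x b⟩

theorem mem_reps_of_key_eq {x : LabeledPartition n S} {a b : Letter n} (h : x.key a = some b) :
    b.1 ∈ x.reps ∧ x.Rel a b := by
  have := x.isKey_key a
  rwa [h] at this

/-- The merges of two pairs of unsigned blocks or of one such pair with the signed block. -/
noncomputable def moves (x : LabeledPartition n S) : Finset (Fin n × Option (Letter n)) :=
  open scoped Classical in
  Finset.univ.filter fun m => m.1 ∈ x.reps ∧ ∀ b, m.2 = some b → b.1 ∈ x.reps ∧ b.1 < m.1

theorem mem_moves {x : LabeledPartition n S} {m : Fin n × Option (Letter n)} :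
    m ∈ x.moves ↔ m.1 ∈ x.reps ∧ ∀ b, m.2 = some b → b.1 ∈ x.reps ∧ b.1 < m.1 := by
  simp [moves]

/-! ### One sign: covering relations as merges -/

section Unique

variable [Unique S]

theorem IsZero.rel {x : LabeledPartition n S} {a b : Letter n} (ha : x.IsZero a)
    (hb : x.IsZero b) : x.Rel a b := by
  obtain ⟨σ, hσ⟩ := Option.isSome_iff_exists.1 (isZero_iff_sign.1 ha)
  obtain ⟨τ, hτ⟩ := Option.isSome_iff_exists.1 (isZero_iff_sign.1 hb)
  rw [Subsingleton.elim τ σ] at hτ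
  exact x.sign_inj _ _ σ hσ hτ

/-- The condition on signs is automatic: a block of `y` that contains a signed block of `x` contains
some letter together with its bar, so it is signed, and there is only one sign to carry. -/
theorem le_iff_rel {x y : LabeledPartition n S} :
    x ≤ y ↔ ∀ a b, x.Rel a b → y.Rel a b := by
  constructor
  · intro h a b hab
    obtain ⟨T, hT, haT⟩ := Refines.partition_le h (x.part_mem a)
    exact (y.partition.part_eq_of_mem hT (haT (x.mem_part_self a))).trans
      (y.partition.part_eq_of_mem hT (haT (mem_part.2 hab.symm))).symm
  · intro h
    have hsub : ∀ a, x.partition.part a ⊆ y.partition.part a := fun a b hb =>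
      mem_part.2 (h _ _ (mem_part.1 hb))
    refine ⟨fun B σ hB => ?_, fun R hR _ => ?_⟩
    · obtain ⟨a, rfl⟩ := exists_eq_part (mem_of_sign hB)
      have hz : y.IsZero a := h _ _ (isZero_iff_sign.2 (by rw [hB]; rfl))
      obtain ⟨τ, hτ⟩ := Option.isSome_iff_exists.1 (isZero_iff_sign.1 hz)
      rw [Subsingleton.elim τ σ] at hτ
      exact ⟨_, hτ, hsub a⟩
    · obtain ⟨a, rfl⟩ := exists_eq_part hR
      exact ⟨_, y.part_mem a, hsub a, Finset.image_subset_image (hsub a)⟩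

open scoped Classical in
/-- The labeled partition whose blocks are the fibres of `f`, the fibre of `none` being signed. -/
noncomputable def ofKey (S : Type*) [Unique S] (f : Letter n → Option (Letter n))
    (hf : ∀ a, f (bar a) = (f a).map bar) : LabeledPartition n S where
  partition := Finpartition.ofSetoid (Setoid.ker f)
  sign R := if R ∈ (Finpartition.ofSetoid (Setoid.ker f)).parts ∧ barSet R = R then some default
    else none
  bar_mem R hR := by
    obtain ⟨a, ha⟩ := (Finpartition.ofSetoid (Setoid.ker f)).nonempty_of_mem_parts hR
    have h1 := (Finpartition.ofSetoid (Setoid.ker f)).part_eq_of_mem hR ha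
    have h2 : barSet R = (Finpartition.ofSetoid (Setoid.ker f)).part (bar a) := by
      ext b
      rw [mem_barSet, ← h1, Finpartition.mem_part_ofSetoid_iff_rel,
        Finpartition.mem_part_ofSetoid_iff_rel, Setoid.ker_def, Setoid.ker_def, hf, hf]
      constructor
      · intro h
        rw [h, Option.map_map, show bar ∘ bar = (id : Letter n → Letter n) from funext bar_bar,
          Option.map_id, id]
      · intro h
        rw [← h, Option.map_map, show bar ∘ bar = (id : Letter n → Letter n) from funext bar_bar,
          Option.map_id, id]
    rw [h2]
    exact (Finpartition.ofSetoid (Setoid.ker f)).part_mem.2 (Finset.mem_univ _)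
  signed_iff R := by split_ifs with h <;> simp [h]
  sign_inj R R' σ h h' := by
    have key : ∀ {R : Finset (Letter n)},
        R ∈ (Finpartition.ofSetoid (Setoid.ker f)).parts ∧ barSet R = R →
        ∃ a, f a = none ∧ R = (Finpartition.ofSetoid (Setoid.ker f)).part a := by
      rintro R ⟨hR, hbar⟩
      obtain ⟨a, ha⟩ := (Finpartition.ofSetoid (Setoid.ker f)).nonempty_of_mem_parts hR
      have h1 := (Finpartition.ofSetoid (Setoid.ker f)).part_eq_of_mem hR ha
      refine ⟨a, ?_, h1.symm⟩
      have h2 : bar a ∈ (Finpartition.ofSetoid (Setoid.ker f)).part a := by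
        rw [h1, ← hbar]
        exact Finset.mem_image_of_mem _ ha
      rw [Finpartition.mem_part_ofSetoid_iff_rel, Setoid.ker_def, hf] at h2
      exact map_bar_eq_self.1 h2.symm
    split_ifs at h with hR
    split_ifs at h' with hR'
    obtain ⟨a, ha, rfl⟩ := key hR
    obtain ⟨b, hb, rfl⟩ := key hR'
    ext c
    rw [Finpartition.mem_part_ofSetoid_iff_rel, Finpartition.mem_part_ofSetoid_iff_rel,
      Setoid.ker_def, Setoid.ker_def, ha, hb]

theorem rel_ofKey {f : Letter n → Option (Letter n)} {hf : ∀ a, f (bar a) = (f a).map bar}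
    {a b : Letter n} : (ofKey S f hf).Rel a b ↔ f a = f b := by
  classical
  rw [← mem_part]
  exact Finpartition.mem_part_ofSetoid_iff_rel.trans (Setoid.ker_def.trans eq_comm)

theorem isZero_ofKey {f : Letter n → Option (Letter n)} {hf : ∀ a, f (bar a) = (f a).map bar}
    {a : Letter n} : (ofKey S f hf).IsZero a ↔ f a = none := by
  rw [IsZero, rel_ofKey, hf, eq_comm, map_bar_eq_self]

theorem key_eq_key_iff {x : LabeledPartition n S} {a b : Letter n} :
    x.key a = x.key b ↔ x.Rel a b := by
  refine ⟨fun h => ?_, fun h => (x.isKey_key a).unique (x.isKey_key b) h⟩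
  have ha := x.isKey_key a
  have hb := x.isKey_key b
  rw [h] at ha
  rcases hk : x.key b with _ | u
  · rw [hk] at ha hb
    exact IsZero.rel ha hb
  · rw [hk] at ha hb
    exact ha.2.trans hb.2.symm

/-- The action on normal forms of a merge: the representative `j` and its bar are replaced by `t`
and its bar, where `t = none` stands for the signed block. -/
def moveMap (j : Fin n) (t : Option (Letter n)) : Option (Letter n) → Option (Letter n)
  | none => none
  | some b => if b.1 = j then (if b.2 then t.map bar else t) else some b

theorem moveMap_of_ne {j : Fin n} {t : Option (Letter n)} {b : Letter n} (h : b.1 ≠ j) :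
    moveMap j t (some b) = some b := by
  simp [moveMap, h]

theorem moveMap_map_bar (j : Fin n) (t u : Option (Letter n)) :
    moveMap j t (u.map bar) = (moveMap j t u).map bar := by
  rcases u with _ | ⟨i, c⟩
  · rfl
  · by_cases h : i = j
    · have hbb : bar ∘ bar = (id : Letter n → Letter n) := funext bar_bar
      cases c
      · simp [moveMap, bar, h]
      · simp [moveMap, bar, h]
        simp [hbb]
    · simp [moveMap, bar, h]

/-- The labeled partition that arises from `x` by merging blocks: the block of the representative
`j` is merged with the block of the letter `t`, or moved to the signed block if `t = none`. -/
noncomputable def move (x : LabeledPartition n S) (m : Fin n × Option (Letter n)) :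
    LabeledPartition n S :=
  ofKey S (fun a => moveMap m.1 m.2 (x.key a)) fun a => by rw [key_bar, moveMap_map_bar]

theorem rel_move {x : LabeledPartition n S} {m : Fin n × Option (Letter n)} {a b : Letter n} :
    (x.move m).Rel a b ↔ moveMap m.1 m.2 (x.key a) = moveMap m.1 m.2 (x.key b) := rel_ofKey

theorem isZero_move {x : LabeledPartition n S} {m : Fin n × Option (Letter n)} {a : Letter n} :
    (x.move m).IsZero a ↔ moveMap m.1 m.2 (x.key a) = none := isZero_ofKey

theorem le_move (x : LabeledPartition n S) (m : Fin n × Option (Letter n)) : x ≤ x.move m :=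
  le_iff_rel.2 fun a b h => by rw [rel_move, key_eq_key_iff.2 h]

theorem reps_anti {x y : LabeledPartition n S} (h : x ≤ y) : y.reps ⊆ x.reps := by
  intro i hi
  rw [mem_reps] at hi ⊢
  rw [le_iff_rel] at h
  exact ⟨fun hz => hi.1 (h _ _ hz), fun j hj c hc => hi.2 j hj c (h _ _ hc)⟩

/-- The block of `j` is absorbed by the signed block or by a block with a smaller representative, so
`j` is lost and no other representative is. -/
theorem reps_move {x : LabeledPartition n S} {m : Fin n × Option (Letter n)} (hm : m ∈ x.moves) :
    (x.move m).reps = x.reps.erase m.1 := by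
  obtain ⟨j, t⟩ := m
  rw [mem_moves] at hm
  obtain ⟨hj, ht⟩ := hm
  dsimp only at hj ht
  ext i
  rw [Finset.mem_erase]
  constructor
  · intro hi
    refine ⟨?_, reps_anti (le_move x _) hi⟩
    rintro rfl
    rw [mem_reps] at hi
    rcases t with _ | b
    · refine hi.1 (isZero_move.2 ?_)
      rw [key_of_mem_reps hj]
      simp [moveMap]
    · obtain ⟨hb, hlt⟩ := ht b rfl
      refine hi.2 b.1 hlt b.2 (rel_move.2 ?_)
      rw [key_of_mem_reps (b := (i, false)) hj, key_of_mem_reps (b := (b.1, b.2)) hb, moveMap_of_ne hlt.ne]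
      simp [moveMap]
  · rintro ⟨hne, hi⟩
    have hk : moveMap j t (x.key (i, false)) = some (i, false) := by
      rw [key_of_mem_reps hi, moveMap_of_ne hne]
    rw [mem_reps, isZero_move]
    refine ⟨by simp [hk], fun l hl c hc => ?_⟩
    rw [rel_move, hk] at hc
    rcases hlc : x.key (l, c) with _ | b
    · rw [hlc] at hc
      simp [moveMap] at hc
    · obtain ⟨hb, hrel⟩ := mem_reps_of_key_eq hlc
      have hbl : b.1 ≤ l := le_of_rel_of_mem_reps hb hrel
      rw [hlc] at hc
      by_cases hbj : b.1 = j
      · rcases t with _ | d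
        · cases hb2 : b.2 <;> simp [moveMap, hbj, hb2] at hc
        · have hd : d.1 = i := by
            cases hb2 : b.2 <;> simp [moveMap, hbj, hb2] at hc
            · rw [hc]
            · exact congrArg Prod.fst hc
          -- The block of `j` can only bring in indices that are at least `j`, and these exceed the
          -- representative `i` that absorbs it.
          have := (ht d rfl).2
          rw [hd, ← hbj] at this
          exact absurd (this.trans_le hbl) (not_lt.2 hl.le)
      · rw [moveMap_of_ne hbj, Option.some.injEq] at hc
        rw [hc] at hbl
        exact absurd hbl (not_le.2 hl)

theorem key_move {x : LabeledPartition n S} {m : Fin n × Option (Letter n)} (hm : m ∈ x.moves)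
    (a : Letter n) : (x.move m).key a = moveMap m.1 m.2 (x.key a) := by
  refine IsKey.key_eq ?_
  rcases hk : moveMap m.1 m.2 (x.key a) with _ | b
  · exact isZero_move.2 hk
  · have hb : b.1 ∈ x.reps ∧ b.1 ≠ m.1 := by
      rcases hka : x.key a with _ | d
      · rw [hka] at hk
        simp [moveMap] at hk
      · rw [hka] at hk
        by_cases hd : d.1 = m.1
        · rcases ht : m.2 with _ | e
          · cases hd2 : d.2 <;> simp [moveMap, hd, hd2, ht] at hk
          · have he : e.1 = b.1 := by
              cases hd2 : d.2 <;> simp [moveMap, hd, hd2, ht] at hk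
              · rw [hk]
              · rw [← hk]; rfl
            have := (mem_moves.1 hm).2 e ht
            rw [he] at this
            exact ⟨this.1, this.2.ne⟩
        · rw [moveMap_of_ne hd, Option.some.injEq] at hk
          rw [← hk]
          exact ⟨(mem_reps_of_key_eq hka).1, hd⟩
    refine ⟨?_, ?_⟩
    · rw [reps_move hm]
      exact Finset.mem_erase.2 ⟨hb.2, hb.1⟩
    · rw [rel_move, hk, key_of_mem_reps hb.1, moveMap_of_ne hb.2]

/-- The lost representative recovers `j`, and the new normal form of `(j, false)` recovers the
target. -/
theorem move_injOn (x : LabeledPartition n S) : Set.InjOn x.move x.moves := by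
  intro m hm m' hm' h
  have h1 : m.1 = m'.1 := by
    have hr := reps_move hm
    rw [h, reps_move hm'] at hr
    by_contra hne
    have := hr ▸ Finset.mem_erase.2 ⟨hne, (mem_moves.1 hm).1⟩
    exact absurd this (Finset.notMem_erase _ _)
  have h2 : ∀ {p}, p ∈ x.moves → (x.move p).key (p.1, false) = p.2 := fun hp => by
    rw [key_move hp, key_of_mem_reps (mem_moves.1 hp).1]
    simp [moveMap]
  refine Prod.ext h1 ?_
  rw [← h2 hm, ← h2 hm', h, h1]

/-- In `y` every letter is related to its new normal form, or signed if that is `none`; hence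
letters with equal new normal forms are related in `y`. -/
theorem move_le {x y : LabeledPartition n S} {j : Fin n} {t : Option (Letter n)} (h : x ≤ y)
    (hz : t = none → y.IsZero (j, false)) (ht : ∀ b, t = some b → y.Rel (j, false) b) :
    x.move (j, t) ≤ y := by
  rw [le_iff_rel] at h ⊢
  have key : ∀ a, (moveMap j t (x.key a) = none → y.IsZero a) ∧
      ∀ b, moveMap j t (x.key a) = some b → y.Rel a b := by
    intro a
    rcases hk : x.key a with _ | d
    · exact ⟨fun _ => h _ _ (key_eq_none_iff.1 hk), fun b hb => by simp [moveMap] at hb⟩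
    · have hd := h _ _ (mem_reps_of_key_eq hk).2
      by_cases hdj : d.1 = j
      · rcases t with _ | e
        · refine ⟨fun _ => ?_, fun b hb => ?_⟩
          · exact ((isZero_iff_fst (a := (j, false)) (b := d) hdj.symm).1 (hz rfl)).of_rel hd.symm
          · cases hd2 : d.2 <;> simp [moveMap, hdj, hd2] at hb
        · have he := ht e rfl
          refine ⟨fun hb => ?_, fun b hb => ?_⟩
          · cases hd2 : d.2 <;> simp [moveMap, hdj, hd2] at hb
          · cases hd2 : d.2 <;> simp only [moveMap, hdj, hd2, if_true, Option.map_some,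
              Option.some.injEq, Bool.false_eq_true, if_false] at hb
            · obtain rfl : d = (j, false) := Prod.ext hdj hd2
              exact hb ▸ hd.trans he
            · obtain rfl : d = (j, true) := Prod.ext hdj hd2
              exact hb ▸ hd.trans he.bar
      · rw [moveMap_of_ne hdj]
        exact ⟨fun hb => by simp at hb, fun b hb => Option.some.inj hb ▸ hd⟩
  intro a b hab
  rw [rel_move] at hab
  dsimp only at hab
  rcases hk : moveMap j t (x.key b) with _ | d
  · exact ((key a).1 (hab.trans hk)).rel ((key b).1 hk)
  · exact ((key a).2 d (hab.trans hk)).trans ((key b).2 d hk).symm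

/-- Either some unsigned block of `x` becomes signed in `y`, or two letters with distinct
representatives become related; if neither happened, `y ≤ x` would follow. -/
theorem exists_move_le {x y : LabeledPartition n S} (h : x < y) :
    ∃ m ∈ x.moves, x.move m ≤ y := by
  have hle := le_iff_rel.1 h.le
  by_cases hzero : ∃ i ∈ x.reps, y.IsZero (i, false)
  · obtain ⟨i, hi, hz⟩ := hzero
    exact ⟨(i, none), mem_moves.2 ⟨hi, fun b hb => by simp at hb⟩,
      move_le h.le (fun _ => hz) fun b hb => by simp at hb⟩
  · push Not at hzero
    have hzero' : ∀ a, y.IsZero a → x.IsZero a := by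
      intro a ha
      rcases hk : x.key a with _ | d
      · exact key_eq_none_iff.1 hk
      · obtain ⟨hd, had⟩ := mem_reps_of_key_eq hk
        exact absurd ((isZero_iff_fst (a := d) (b := (d.1, false)) rfl).1
          (ha.of_rel (hle _ _ had))) (hzero _ hd)
    have hmerge : ∃ a b : Letter n, a.1 ∈ x.reps ∧ b.1 ∈ x.reps ∧ b.1 < a.1 ∧ y.Rel a b := by
      by_contra hno
      push Not at hno
      refine h.not_ge (le_iff_rel.2 fun a b hab => ?_)
      rcases hka : x.key a with _ | d
      · have hza := key_eq_none_iff.1 hka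
        exact hza.rel (hzero' b (IsZero.of_rel (hle _ _ hza) hab))
      · rcases hkb : x.key b with _ | e
        · have hzb := key_eq_none_iff.1 hkb
          exact (hzero' a (IsZero.of_rel (hle _ _ hzb) hab.symm)).rel hzb
        · obtain ⟨hd, had⟩ := mem_reps_of_key_eq hka
          obtain ⟨he, hbe⟩ := mem_reps_of_key_eq hkb
          have hde : y.Rel d e := ((hle _ _ had).symm.trans hab).trans (hle _ _ hbe)
          rcases lt_trichotomy d.1 e.1 with hlt | heq | hlt
          · exact absurd hde.symm (hno e d he hd hlt)
          · by_cases hdeq : d = e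
            · exact had.trans (hdeq ▸ hbe.symm)
            · have hbar : e = bar d := by
                obtain ⟨i, c⟩ := d
                obtain ⟨j, c'⟩ := e
                cases heq
                cases c <;> cases c' <;> simp_all [_root_.bar]
              rw [hbar] at hde
              exact absurd (hzero' d hde) (not_isZero_of_mem_reps hd)
          · exact absurd hde (hno d e hd he hlt)
    obtain ⟨⟨j, c⟩, b, hj, hb, hlt, hrel⟩ := hmerge
    -- Bar both letters if necessary, so that the larger one becomes unbarred as in `moves`.
    obtain ⟨b', hb', hrel'⟩ : ∃ b' : Letter n, b'.1 = b.1 ∧ y.Rel (j, false) b' := by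
      cases c with
      | false => exact ⟨b, rfl, hrel⟩
      | true => exact ⟨bar b, rfl, hrel.bar⟩
    refine ⟨(j, some b'), mem_moves.2 ⟨hj, fun d hd => ?_⟩, move_le h.le (fun h => by simp at h)
      fun d hd => ?_⟩
    · rw [← Option.some.inj hd, hb']
      exact ⟨hb, hlt⟩
    · rwa [← Option.some.inj hd]

theorem reps_ssubset {x y : LabeledPartition n S} (h : x < y) : y.reps ⊂ x.reps := by
  obtain ⟨m, hm, hle⟩ := exists_move_le h
  refine (reps_anti hle).trans_ssubset ?_
  rw [reps_move hm]
  exact Finset.erase_ssubset (mem_moves.1 hm).1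

theorem lt_move {x : LabeledPartition n S} {m : Fin n × Option (Letter n)} (hm : m ∈ x.moves) :
    x < x.move m := by
  refine lt_of_le_of_ne (le_move x m) fun h => ?_
  have h1 := reps_move hm
  rw [← h] at h1
  exact Finset.notMem_erase m.1 x.reps (h1 ▸ (mem_moves.1 hm).1)

/-- The number of representatives drops strictly along `<` and by exactly one under a move, so
nothing fits in between; conversely every strict relation dominates a move. -/
theorem covBy_iff_exists_move {x y : LabeledPartition n S} :
    x ⋖ y ↔ ∃ m ∈ x.moves, x.move m = y := by
  constructor
  · intro h
    obtain ⟨m, hm, hle⟩ := exists_move_le h.lt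
    exact ⟨m, hm, hle.eq_of_not_lt fun hlt => h.2 (lt_move hm) hlt⟩
  · rintro ⟨m, hm, rfl⟩
    refine ⟨lt_move hm, fun w h1 h2 => ?_⟩
    have hc1 := Finset.card_lt_card (reps_ssubset h1)
    have hc2 := Finset.card_lt_card (reps_ssubset h2)
    rw [reps_move hm, Finset.card_erase_of_mem (mem_moves.1 hm).1] at hc2
    omega

end Unique

end LabeledPartition

/-! ### Labels of the covering relations -/

namespace LabeledPartition

variable {n : ℕ} {S : Type*}

theorem rep_le {R : Finset (Letter n)} {a : Letter n} (ha : a ∈ R) : rep R ≤ (a.1 : ℕ) + 1 :=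
  Nat.sInf_le ⟨a, ha, rfl⟩

theorem rep_part {x : LabeledPartition n S} {i : Fin n} (hi : i ∈ x.reps) :
    rep (x.partition.part (i, false)) = (i : ℕ) + 1 := by
  refine le_antisymm (rep_le (x.mem_part_self _)) (le_csInf ⟨_, _, x.mem_part_self _, rfl⟩ ?_)
  rintro _ ⟨a, ha, rfl⟩
  have : i ≤ a.1 := le_of_rel_of_mem_reps (b := (i, false)) hi (mem_part.1 ha)
  exact Nat.succ_le_succ this

theorem isNormalizedUnsigned_iff {x : LabeledPartition n S} {R : Finset (Letter n)} :
    IsNormalizedUnsigned x R ↔ ∃ i ∈ x.reps, R = x.partition.part (i, false) := by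
  constructor
  · rintro ⟨hR, hs, ⟨i, c⟩, ha, hc, hi⟩
    dsimp only at hc hi
    subst hc
    have hRi := (x.partition.part_eq_of_mem hR ha).symm
    refine ⟨i, mem_reps.2 ⟨fun hz => ?_, fun j hj d hd => ?_⟩, hRi⟩
    · rw [isZero_iff_sign, ← hRi, hs] at hz
      simp at hz
    · have hmem : (j, d) ∈ R := hRi ▸ mem_part.2 hd
      have h1 : rep R ≤ (j : ℕ) + 1 := rep_le hmem
      have h2 : (j : ℕ) < i := hj
      omega
  · rintro ⟨i, hi, rfl⟩
    refine ⟨x.part_mem _, ?_, (i, false), x.mem_part_self _, rfl, (rep_part hi).symm⟩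
    rw [← Option.not_isSome_iff_eq_none, ← isZero_iff_sign]
    exact (mem_reps.1 hi).1

section Unique

variable [Unique S]

theorem moveMap_eq_some_iff {i j : Fin n} {c : Bool} (hij : i ≠ j) {u : Option (Letter n)} :
    moveMap j (some (i, c)) u = some (i, false) ↔ u = some (i, false) ∨ u = some (j, c) := by
  rcases u with _ | ⟨l, d⟩
  · simp [moveMap]
  · by_cases hl : l = j
    · subst hl
      cases c <;> cases d <;> simp [moveMap, bar, hij.symm]
    · simp [moveMap, hl]

theorem part_move {x : LabeledPartition n S} {i j : Fin n} {c : Bool}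
    (hm : (j, some (i, c)) ∈ x.moves) :
    (x.move (j, some (i, c))).partition.part (i, false) =
      x.partition.part (i, false) ∪ x.partition.part (j, c) := by
  obtain ⟨hj, hi⟩ := mem_moves.1 hm
  obtain ⟨hi, hij⟩ := hi _ rfl
  dsimp only at hj hi hij
  ext b
  rw [Finset.mem_union, mem_part, mem_part, mem_part, rel_move,
    key_of_mem_reps (b := (i, false)) hi, moveMap_of_ne (b := (i, false)) hij.ne,
    moveMap_eq_some_iff hij.ne, ← key_eq_key_iff, ← key_eq_key_iff,
    key_of_mem_reps (b := (i, false)) hi, key_of_mem_reps (b := (j, c)) hj]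

theorem rel_move_of_union_mem {x : LabeledPartition n S} {m : Fin n × Option (Letter n)}
    {a b : Letter n}
    (h : x.partition.part a ∪ x.partition.part b ∈ (x.move m).partition.parts) :
    moveMap m.1 m.2 (x.key a) = moveMap m.1 m.2 (x.key b) :=
  rel_move.1 (((x.move m).partition.part_eq_of_mem h
    (Finset.mem_union_left _ (x.mem_part_self a))).trans
    ((x.move m).partition.part_eq_of_mem h (Finset.mem_union_right _ (x.mem_part_self b))).symm)

theorem IsCoherentMerge.exists_eq {x : LabeledPartition n S} {m : Fin n × Option (Letter n)}
    {p : Finset (Letter n) × Finset (Letter n)} (h : IsCoherentMerge x (x.move m) p) :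
    ∃ i, m.2 = some (i, false) := by
  obtain ⟨R, R'⟩ := p
  obtain ⟨hR, hR', hne, hun⟩ := h
  dsimp only at hR hR' hne hun
  obtain ⟨i, hi, rfl⟩ := isNormalizedUnsigned_iff.1 hR
  obtain ⟨j, hj, rfl⟩ := isNormalizedUnsigned_iff.1 hR'
  have hij : i ≠ j := fun h => hne (by rw [h])
  have hrel := rel_move_of_union_mem hun
  rw [key_of_mem_reps (b := (i, false)) hi, key_of_mem_reps (b := (j, false)) hj] at hrel
  by_cases h1 : i = m.1
  · have h2 : j ≠ m.1 := fun h => hij (h1.trans h.symm)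
    rw [moveMap_of_ne (b := (j, false)) h2] at hrel
    exact ⟨j, by simpa [moveMap, h1] using hrel⟩
  · rw [moveMap_of_ne (b := (i, false)) h1] at hrel
    by_cases h2 : j = m.1
    · exact ⟨i, by simpa [moveMap, h2] using hrel.symm⟩
    · rw [moveMap_of_ne (b := (j, false)) h2] at hrel
      simp [hij] at hrel

/-- Every witness pair gives the same minimum, so the label does not depend on the pair chosen in
`label`. -/
theorem IsNoncoherentMerge.exists_eq {x : LabeledPartition n S} {m : Fin n × Option (Letter n)}
    (hm : m ∈ x.moves) {p : Finset (Letter n) × Finset (Letter n)}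
    (h : IsNoncoherentMerge x (x.move m) p) :
    ∃ i, m.2 = some (i, true) ∧ min (rep p.1) (rep p.2) = (i : ℕ) + 1 := by
  obtain ⟨R, R'⟩ := p
  obtain ⟨hR, hR', hne, hun⟩ := h
  dsimp only at hR hR' hne hun ⊢
  obtain ⟨i, hi, rfl⟩ := isNormalizedUnsigned_iff.1 hR
  obtain ⟨j, hj, rfl⟩ := isNormalizedUnsigned_iff.1 hR'
  have hij : i ≠ j := fun h => hne (by rw [h])
  rw [barSet_part] at hun
  have hrel := rel_move_of_union_mem hun
  rw [key_bar, moveMap_map_bar, key_of_mem_reps (b := (i, false)) hi,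
    key_of_mem_reps (b := (j, false)) hj] at hrel
  rw [rep_part hi, rep_part hj]
  have hlt := (mem_moves.1 hm).2
  by_cases h1 : i = m.1
  · have h2 : j ≠ m.1 := fun h => hij (h1.trans h.symm)
    rw [moveMap_of_ne (b := (j, false)) h2] at hrel
    have ht : m.2 = some (j, true) := by simpa [moveMap, h1, bar] using hrel
    have : (j : ℕ) < i := h1 ▸ (hlt _ ht).2
    exact ⟨j, ht, by omega⟩
  · rw [moveMap_of_ne (b := (i, false)) h1] at hrel
    by_cases h2 : j = m.1
    · have ht : m.2 = some (i, true) := by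
        rcases hm2 : m.2 with _ | ⟨l, c⟩
        · simp [moveMap, h2, hm2] at hrel
        · cases c <;> simp [moveMap, h2, hm2, bar] at hrel
          rw [hrel]
      have : (i : ℕ) < j := h2 ▸ (hlt _ ht).2
      exact ⟨i, ht, by omega⟩
    · rw [moveMap_of_ne (b := (j, false)) h2] at hrel
      simp [hij, bar] at hrel

theorem exists_merge {x : LabeledPartition n S} {i j : Fin n} {c : Bool}
    (hm : (j, some (i, c)) ∈ x.moves) :
    IsNormalizedUnsigned x (x.partition.part (i, false)) ∧
      IsNormalizedUnsigned x (x.partition.part (j, false)) ∧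
      x.partition.part (i, false) ≠ x.partition.part (j, false) ∧
      x.partition.part (i, false) ∪ x.partition.part (j, c) ∈
        (x.move (j, some (i, c))).partition.parts := by
  obtain ⟨hj, hi⟩ := mem_moves.1 hm
  obtain ⟨hi, hij⟩ := hi _ rfl
  refine ⟨isNormalizedUnsigned_iff.2 ⟨i, hi, rfl⟩, isNormalizedUnsigned_iff.2 ⟨j, hj, rfl⟩,
    fun h => hij.ne ?_, ?_⟩
  · exact congrArg Prod.fst (eq_of_rel_of_mem_reps (a := (i, false)) (b := (j, false)) hi hj h)
  · rw [← part_move hm]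
    exact part_mem _ _

theorem mem_signedBlock {x : LabeledPartition n S} {σ : S} {a : Letter n} :
    a ∈ x.signedBlock σ ↔ x.IsZero a := by
  simp only [signedBlock, Finset.mem_filter, Finset.mem_univ, true_and]
  rw [isZero_iff_sign]
  constructor
  · rintro ⟨B, hB, ha⟩
    rw [x.partition.part_eq_of_mem (mem_of_sign hB) ha, hB]
    rfl
  · intro h
    obtain ⟨τ, hτ⟩ := Option.isSome_iff_exists.1 h
    rw [Subsingleton.elim τ σ] at hτ
    exact ⟨_, hτ, x.mem_part_self a⟩

section Label

variable [Fintype S] [LinearOrder S]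

/-- The second coordinate is left open because the first one alone excludes these edges from the
decreasing chains to the full block. -/
theorem exists_label_move_coherent {x : LabeledPartition n S} {i j : Fin n}
    (hm : (j, some (i, false)) ∈ x.moves) :
    ∃ k, label x (x.move (j, some (i, false))) = toLex (0, k) := by
  have h : ∃ p, IsCoherentMerge x (x.move (j, some (i, false))) p :=
    ⟨(x.partition.part (i, false), x.partition.part (j, false)), exists_merge hm⟩
  rw [label, dif_pos h]
  exact ⟨_, rfl⟩

theorem label_move_noncoherent {x : LabeledPartition n S} {i j : Fin n}
    (hm : (j, some (i, true)) ∈ x.moves) :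
    label x (x.move (j, some (i, true))) = toLex (2, (i : ℕ) + 1) := by
  have h0 : ¬ ∃ p, IsCoherentMerge x (x.move (j, some (i, true))) p := by
    rintro ⟨p, hp⟩
    obtain ⟨l, hl⟩ := hp.exists_eq
    simp at hl
  have h : ∃ p, IsNoncoherentMerge x (x.move (j, some (i, true))) p := by
    refine ⟨(x.partition.part (i, false), x.partition.part (j, false)), ?_⟩
    have := exists_merge hm
    rwa [show (j, true) = bar (j, false) from rfl, ← barSet_part] at this
  rw [label, dif_neg h0, dif_pos h]
  obtain ⟨l, hl, hmin⟩ := h.choose_spec.exists_eq hm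
  have : i = l := by simpa using hl
  rw [hmin, this]

theorem label_move_none {x : LabeledPartition n S} {j : Fin n} (hm : (j, none) ∈ x.moves) :
    label x (x.move (j, none)) = toLex (1, 1) := by
  have h0 : ¬ ∃ p, IsCoherentMerge x (x.move (j, none)) p := by
    rintro ⟨p, hp⟩
    obtain ⟨l, hl⟩ := hp.exists_eq
    simp at hl
  have h1 : ¬ ∃ p, IsNoncoherentMerge x (x.move (j, none)) p := by
    rintro ⟨p, hp⟩
    obtain ⟨l, hl, -⟩ := hp.exists_eq hm
    simp at hl
  have hj := (mem_moves.1 hm).1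
  have h2 : ∃ σ, x.signedBlock σ ⊂ (x.move (j, none)).signedBlock σ := by
    refine ⟨default, Finset.ssubset_iff_subset_ne.2 ⟨fun a ha => ?_, fun h => ?_⟩⟩
    · rw [mem_signedBlock] at ha ⊢
      exact le_iff_rel.1 (le_move x _) _ _ ha
    · have hz : (j, false) ∈ (x.move (j, none)).signedBlock default := by
        rw [mem_signedBlock, isZero_move, key_of_mem_reps (b := (j, false)) hj]
        simp [moveMap]
      rw [← h, mem_signedBlock] at hz
      exact (mem_reps.1 hj).1 hz
  -- With a single sign both sets counted in `label` are singletons, whether or not the sign already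
  -- occurs.
  have hcard : ∀ s : Finset S, s.Nonempty → s.card = 1 := fun s hs =>
    le_antisymm (Finset.card_le_one_of_subsingleton s) hs.card_pos
  rw [label, dif_neg h0, dif_neg h1, dif_pos h2]
  split_ifs with h3
  · rw [hcard _ ⟨h2.choose, by simp [h3]⟩]
  · rw [hcard _ (Finset.Nonempty.inl ⟨h2.choose, by
      rw [Finset.mem_filter]; exact ⟨Finset.mem_univ _, le_rfl⟩⟩)]

end Label

end Unique

end LabeledPartition

/-! ### The recursion for the number of decreasing chains -/

/-- The number of decreasing chains to the top from a labeled partition with `k` pairs of unsigned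
blocks, if the noncoherent labels may use the `r` smallest of the `k` representatives. -/
def decreasingChainCount : ℕ → ℕ → ℕ
  | 0, _ => 1
  | k + 1, r => ∑ s ∈ Finset.range (r + 1), (k + 1 - s) * decreasingChainCount k s

/-- Splitting off the last summand gives `D (k + 1) (r + 1) = D (k + 1) r + (k - r) * D k (r + 1)`,
and the closed form satisfies this because `2 * (r + 1) + (k - r) = k + r + 2`. -/
theorem decreasingChainCount_mul (k r : ℕ) (h : r ≤ k) :
    decreasingChainCount k r * (r ! * 2 ^ r) = (k + r)! := by
  induction k generalizing r with
  | zero =>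
    obtain rfl : r = 0 := by omega
    simp [decreasingChainCount]
  | succ k ihk =>
    induction r with
    | zero =>
      have := ihk 0 (by omega)
      simp only [Nat.factorial_zero, pow_zero, mul_one, add_zero] at this
      simp [decreasingChainCount, this, Nat.factorial_succ]
    | succ r ihr =>
      have h1 := ihr (by omega)
      have h2 : decreasingChainCount (k + 1) (r + 1) = decreasingChainCount (k + 1) r +
          (k - r) * decreasingChainCount k (r + 1) := by
        rw [decreasingChainCount, Finset.sum_range_succ, decreasingChainCount,
          Nat.add_sub_add_right]
      have h3 : (r + 1)! * 2 ^ (r + 1) = 2 * (r + 1) * (r ! * 2 ^ r) := by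
        rw [Nat.factorial_succ]
        ring
      have h4 : (k + 1 + (r + 1))! = (k + r + 2) * (k + 1 + r)! := by
        rw [show k + 1 + (r + 1) = (k + 1 + r) + 1 by ring, Nat.factorial_succ]
        ring
      have h5 : (k - r) * decreasingChainCount k (r + 1) * ((r + 1)! * 2 ^ (r + 1)) =
          (k - r) * (k + 1 + r)! := by
        -- For `r = k` the induction hypothesis at `r + 1` is not available, but the coefficient `k
        -- - r` vanishes.
        rcases Nat.eq_or_lt_of_le (show r ≤ k by omega) with rfl | hlt
        · simp
        · rw [mul_assoc, ihk (r + 1) hlt, show k + (r + 1) = k + 1 + r by ring]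
      have h6 : 2 * (r + 1) + (k - r) = k + r + 2 := by omega
      rw [h2, add_mul, h5, h4, ← h6, add_mul, ← h1, h3]
      ring

theorem decreasingChainCount_self (n : ℕ) : decreasingChainCount n n = (2 * n - 1)‼ := by
  have h := decreasingChainCount_mul n n le_rfl
  have h2 : (n + n)! = (2 * n - 1)‼ * (n ! * 2 ^ n) := by
    cases n with
    | zero => simp
    | succ m =>
      rw [show m + 1 + (m + 1) = (2 * m + 1) + 1 by ring, Nat.factorial_eq_mul_doubleFactorial,
        show 2 * m + 1 + 1 = 2 * (m + 1) by ring, Nat.doubleFactorial_two_mul,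
        show 2 * (m + 1) - 1 = 2 * m + 1 by omega]
      ring
  rw [h2] at h
  exact Nat.eq_of_mul_eq_mul_right (by positivity) h

/-- The number of elements up to `i` is the rank of `i`, and the ranks run through `1, …, B.card`
once each. -/
theorem Finset.sum_card_filter_le {α M : Type*} [LinearOrder α] [AddCommMonoid M] (B : Finset α)
    (F : ℕ → M) :
    ∑ i ∈ B, F (B.filter (· ≤ i)).card = ∑ s ∈ Finset.range B.card, F (s + 1) := by
  induction B using Finset.induction_on_max with
  | empty => simp
  | insert a B ha ih =>
    have hn : a ∉ B := fun h => lt_irrefl _ (ha a h)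
    rw [Finset.sum_insert hn, Finset.card_insert_of_notMem hn, Finset.sum_range_succ, ← ih,
      add_comm]
    congr 1
    · refine Finset.sum_congr rfl fun i hi => ?_
      rw [Finset.filter_insert, if_neg (not_le.2 (ha i hi))]
    · rw [Finset.filter_true_of_mem, Finset.card_insert_of_notMem hn]
      intro b hb
      rcases Finset.mem_insert.1 hb with rfl | hb
      · exact le_rfl
      · exact (ha b hb).le

/-! ### Counting decreasing chains by their first step -/

namespace LabeledPartition

variable {n : ℕ} {S : Type*}

theorem sum_moves {M : Type*} [AddCommMonoid M] (x : LabeledPartition n S)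
    (F : Fin n × Option (Letter n) → M) :
    ∑ m ∈ x.moves, F m = ∑ j ∈ x.reps, (F (j, none) +
      ∑ i ∈ x.reps.filter (· < j), (F (j, some (i, true)) + F (j, some (i, false)))) := by
  classical
  rw [moves, Finset.sum_filter, Fintype.sum_prod_type, ← Finset.sum_subset
    (Finset.subset_univ x.reps)]
  · refine Finset.sum_congr rfl fun j hj => ?_
    rw [Fintype.sum_option, Fintype.sum_prod_type, if_pos ⟨hj, fun b hb => by simp at hb⟩,
      ← Finset.sum_subset (Finset.subset_univ (x.reps.filter (· < j)))]
    · congr 1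
      refine Finset.sum_congr rfl fun i hi => ?_
      have hi' := Finset.mem_filter.1 hi
      rw [Fintype.sum_bool, if_pos, if_pos] <;>
      · refine ⟨hj, fun b hb => ?_⟩
        rw [← Option.some.inj hb]
        exact hi'
    · intro i _ hi
      rw [Fintype.sum_bool, if_neg, if_neg, add_zero] <;>
      · rintro ⟨-, h⟩
        exact hi (Finset.mem_filter.2 (h _ rfl))
  · intro j _ hj
    exact Finset.sum_eq_zero fun t _ => if_neg fun h => hj h.1

theorem isZero_of_reps_eq_empty {x : LabeledPartition n S} (h : x.reps = ∅) (a : Letter n) :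
    x.IsZero a := by
  rcases hk : x.key a with _ | b
  · exact key_eq_none_iff.1 hk
  · have := (mem_reps_of_key_eq hk).1
    simp [h] at this

theorem eq_of_reps_eq_empty [Unique S] {x y : LabeledPartition n S} (hx : x.reps = ∅) (hy : y.reps = ∅) :
    x = y :=
  le_antisymm
    (le_iff_rel.2 fun a b _ => (isZero_of_reps_eq_empty hy a).rel (isZero_of_reps_eq_empty hy b))
    (le_iff_rel.2 fun a b _ => (isZero_of_reps_eq_empty hx a).rel (isZero_of_reps_eq_empty hx b))

theorem reps_full (σ : S) : (full n σ).reps = ∅ := by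
  refine Finset.eq_empty_of_forall_notMem fun i hi => (mem_reps.1 hi).1 ?_
  have h : ∀ a : Letter n, (full n σ).partition.part a = Finset.univ := fun a =>
    Finset.mem_singleton.1 (Finpartition.parts_top_subset _ ((full n σ).part_mem a))
  exact (h _).trans (h _).symm

theorem reps_zeroHat : (zeroHat n S).reps = Finset.univ := by
  have h : ∀ {a b : Letter n}, (zeroHat n S).Rel a b → a = b := by
    intro a b hab
    have hb : b ∈ (zeroHat n S).partition.part a := mem_part.2 hab.symm
    obtain ⟨c, -, hc⟩ := Finpartition.mem_bot_iff.1 ((zeroHat n S).part_mem a)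
    have ha := (zeroHat n S).mem_part_self a
    rw [← hc, Finset.mem_singleton] at ha hb
    exact ha.trans hb.symm
  refine Finset.eq_univ_of_forall fun i => mem_reps.2 ⟨fun hz => ?_, fun j hj c hc => ?_⟩
  · exact bar_ne _ (h hz).symm
  · exact hj.ne (congrArg Prod.fst (h hc))

section Label

variable [Fintype S] [LinearOrder S]

/-- The saturated chains from `x` to `t`, without their first element `x`, whose word of labels is
weakly decreasing when preceded by `L`. -/
def decreasingTails (t x : LabeledPartition n S) (L : ℕ ×ₗ ℕ) : Set (List (LabeledPartition n S)) :=
  {c | (x :: c).IsChain (· ⋖ ·) ∧ (x :: c).getLast? = some t ∧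
    (L :: List.zipWith label (x :: c) c).IsChain (· ≥ ·)}

theorem nil_mem_decreasingTails {t x : LabeledPartition n S} {L : ℕ ×ₗ ℕ} :
    [] ∈ decreasingTails t x L ↔ x = t := by
  simp [decreasingTails]

theorem cons_mem_decreasingTails {t x y : LabeledPartition n S} {L : ℕ ×ₗ ℕ}
    {c : List (LabeledPartition n S)} :
    y :: c ∈ decreasingTails t x L ↔ x ⋖ y ∧ label x y ≤ L ∧ c ∈ decreasingTails t y (label x y) := by
  simp only [decreasingTails, Set.mem_ofPred_eq, List.isChain_cons_cons, List.zipWith_cons_cons,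
    List.getLast?_cons_cons, ge_iff_le]
  tauto

variable [Unique S]

theorem decreasingTails_of_reps_eq_empty {t x : LabeledPartition n S} (ht : t.reps = ∅)
    (hx : x.reps = ∅) (L : ℕ ×ₗ ℕ) : decreasingTails t x L = {[]} := by
  ext c
  rw [Set.mem_singleton_iff]
  constructor
  · intro h
    rcases c with _ | ⟨y, c⟩
    · rfl
    · obtain ⟨m, hm, -⟩ := covBy_iff_exists_move.1 (cons_mem_decreasingTails.1 h).1
      have := (mem_moves.1 hm).1
      simp [hx] at this
  · rintro rfl
    exact nil_mem_decreasingTails.2 (eq_of_reps_eq_empty hx ht)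

theorem decreasingTails_eq_biUnion {t x : LabeledPartition n S} (ht : t.reps = ∅)
    (hx : x.reps ≠ ∅) (L : ℕ ×ₗ ℕ) :
    decreasingTails t x L = ⋃ m ∈ (x.moves.filter fun m => label x (x.move m) ≤ L : Set _),
      List.cons (x.move m) '' decreasingTails t (x.move m) (label x (x.move m)) := by
  ext c
  simp only [Set.mem_iUnion, Set.mem_image, Finset.mem_coe, Finset.mem_filter, exists_prop]
  constructor
  · intro h
    rcases c with _ | ⟨y, c⟩
    · exact absurd (nil_mem_decreasingTails.1 h ▸ ht) hx
    · obtain ⟨h1, h2, h3⟩ := cons_mem_decreasingTails.1 h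
      obtain ⟨m, hm, rfl⟩ := covBy_iff_exists_move.1 h1
      exact ⟨m, ⟨hm, h2⟩, c, h3, rfl⟩
  · rintro ⟨m, ⟨hm, hL⟩, c, hc, rfl⟩
    exact cons_mem_decreasingTails.2 ⟨covBy_iff_exists_move.2 ⟨m, hm, rfl⟩, hL, hc⟩

theorem finite_decreasingTails {t : LabeledPartition n S} (ht : t.reps = ∅)
    (x : LabeledPartition n S) (L : ℕ ×ₗ ℕ) : (decreasingTails t x L).Finite := by
  induction hk : x.reps.card using Nat.strong_induction_on generalizing x L with
  | _ k ih =>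
    by_cases hx : x.reps = ∅
    · rw [decreasingTails_of_reps_eq_empty ht hx]
      exact Set.finite_singleton _
    · rw [decreasingTails_eq_biUnion ht hx]
      refine (Finset.finite_toSet _).biUnion fun m hm => (ih _ ?_ _ _ rfl).image _
      have hm := (Finset.mem_filter.1 hm).1
      rw [← hk]
      exact Finset.card_lt_card (reps_ssubset (lt_move hm))

theorem ncard_decreasingTails {t x : LabeledPartition n S} (ht : t.reps = ∅)
    (hx : x.reps ≠ ∅) (L : ℕ ×ₗ ℕ) :
    (decreasingTails t x L).ncard = ∑ m ∈ x.moves, if label x (x.move m) ≤ L then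
      (decreasingTails t (x.move m) (label x (x.move m))).ncard else 0 := by
  rw [decreasingTails_eq_biUnion ht hx, (Finset.finite_toSet _).ncard_biUnion
    (fun m _ => (finite_decreasingTails ht _ _).image _), finsum_mem_coe_finset, Finset.sum_filter]
  · refine Finset.sum_congr rfl fun m _ => ?_
    rw [Set.ncard_image_of_injective _ List.cons_injective]
  · intro m hm m' hm' hne
    refine Set.disjoint_left.2 ?_
    rintro _ ⟨c, -, rfl⟩ ⟨c', -, h⟩
    exact hne (move_injOn x (Finset.mem_filter.1 hm).1 (Finset.mem_filter.1 hm').1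
      (List.cons.inj h).1.symm)

/-- A label bounded by `(0, k)` is again coherent, and a coherent merge keeps the smaller
representative; so such a chain never reaches a partition without unsigned blocks. -/
theorem decreasingTails_coherent {t x : LabeledPartition n S} (ht : t.reps = ∅)
    (hx : x.reps ≠ ∅) (k : ℕ) : decreasingTails t x (toLex (0, k)) = ∅ := by
  refine Set.eq_empty_of_forall_notMem fun c hc => ?_
  induction c generalizing x k with
  | nil => exact hx (nil_mem_decreasingTails.1 hc ▸ ht)
  | cons y c ih =>
    obtain ⟨h1, h2, h3⟩ := cons_mem_decreasingTails.1 hc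
    obtain ⟨⟨j, u⟩, hm, rfl⟩ := covBy_iff_exists_move.1 h1
    rcases u with _ | ⟨i, c⟩
    · rw [label_move_none hm, Prod.Lex.toLex_le_toLex] at h2
      simp at h2
    · cases c with
      | true =>
        rw [label_move_noncoherent hm, Prod.Lex.toLex_le_toLex] at h2
        simp at h2
      | false =>
        obtain ⟨l, hl⟩ := exists_label_move_coherent hm
        rw [hl] at h3
        have hi := (mem_moves.1 hm).2 _ rfl
        refine ih (Finset.ne_empty_of_mem (a := i) ?_) l h3
        rw [reps_move hm]
        exact Finset.mem_erase.2 ⟨hi.2.ne, hi.1⟩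

/-- The two bounds are treated in one induction, since a move to the signed block turns a bound `(2,
b)` into `(1, 1)`. Below `(1, 1)` only such moves contribute, which is the case of no usable
representative. -/
theorem ncard_decreasingTails_eq {t : LabeledPartition n S} (ht : t.reps = ∅) (k : ℕ)
    (x : LabeledPartition n S) (hx : x.reps.card = k) :
    (decreasingTails t x (toLex (1, 1))).ncard = decreasingChainCount k 0 ∧
    ∀ b, (decreasingTails t x (toLex (2, b))).ncard =
      decreasingChainCount k (x.reps.filter fun i : Fin n => (i : ℕ) + 1 ≤ b).card := by
  induction k generalizing x with
  | zero =>
    have hx' := Finset.card_eq_zero.1 hx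
    simp [decreasingTails_of_reps_eq_empty ht hx', decreasingChainCount]
  | succ k ih =>
    have hne : x.reps ≠ ∅ := fun h => by simp [h] at hx
    have hcard : ∀ {m}, m ∈ x.moves → (x.move m).reps.card = k := fun {m} hm => by
      rw [reps_move hm, Finset.card_erase_of_mem (mem_moves.1 hm).1, hx]
      rfl
    have hnone : ∀ {j}, j ∈ x.reps → (j, (none : Option (Letter n))) ∈ x.moves := fun hj =>
      mem_moves.2 ⟨hj, fun b hb => by simp at hb⟩
    have hsome : ∀ {i j} (c : Bool), j ∈ x.reps → i ∈ x.reps.filter (· < j) →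
        (j, some (i, c)) ∈ x.moves := fun c hj hi =>
      mem_moves.2 ⟨hj, fun b hb => by
        rw [← Option.some.inj hb]
        exact Finset.mem_filter.1 hi⟩
    have hcoh : ∀ {i j}, (j, some (i, false)) ∈ x.moves →
        (decreasingTails t (x.move (j, some (i, false)))
          (label x (x.move (j, some (i, false))))).ncard = 0 := by
      intro i j hm
      obtain ⟨l, hl⟩ := exists_label_move_coherent hm
      have hi := (mem_moves.1 hm).2 _ rfl
      rw [hl, decreasingTails_coherent ht (Finset.ne_empty_of_mem (a := i) ?_), Set.ncard_empty]
      rw [reps_move hm]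
      exact Finset.mem_erase.2 ⟨hi.2.ne, hi.1⟩
    have hnoncoh : ∀ {i j}, (j, some (i, true)) ∈ x.moves →
        (decreasingTails t (x.move (j, some (i, true))) (toLex (2, (i : ℕ) + 1))).ncard =
          decreasingChainCount k (x.reps.filter (· ≤ i)).card := by
      intro i j hm
      rw [(ih _ (hcard hm)).2, reps_move hm]
      -- The removed representative `j` exceeds `i`, so the representatives up to `i` are untouched.
      congr 2
      have hij : i < j := ((mem_moves.1 hm).2 _ rfl).2
      ext l
      simp only [Finset.mem_filter, Finset.mem_erase, Fin.le_def, Fin.lt_def, ne_eq,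
        Fin.ext_iff] at hij ⊢
      exact ⟨fun h => ⟨h.1.2, by omega⟩, fun h => ⟨⟨by omega, h.1⟩, by omega⟩⟩
    have hsum : ∀ L : ℕ ×ₗ ℕ, toLex (1, 1) ≤ L → (decreasingTails t x L).ncard =
        ∑ j ∈ x.reps, (decreasingChainCount k 0 + ∑ i ∈ x.reps.filter (· < j),
          if toLex (2, (i : ℕ) + 1) ≤ L then
            decreasingChainCount k (x.reps.filter (· ≤ i)).card else 0) := by
      intro L hL
      rw [ncard_decreasingTails ht hne, sum_moves]
      refine Finset.sum_congr rfl fun j hj => ?_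
      rw [label_move_none (hnone hj), if_pos hL, (ih _ (hcard (hnone hj))).1]
      congr 1
      refine Finset.sum_congr rfl fun i hi => ?_
      rw [hcoh (hsome false hj hi), ite_self, add_zero, label_move_noncoherent (hsome true hj hi),
        hnoncoh (hsome true hj hi)]
    refine ⟨?_, fun b => ?_⟩
    · rw [hsum _ le_rfl]
      simp [Prod.Lex.toLex_le_toLex, decreasingChainCount, hx]
    · rw [hsum _ (by simp [Prod.Lex.toLex_le_toLex])]
      have hle : ∀ i : Fin n, toLex (2, (i : ℕ) + 1) ≤ toLex (2, b) ↔ (i : ℕ) + 1 ≤ b := fun i => by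
        simp [Prod.Lex.toLex_le_toLex]
      simp only [hle]
      -- The moves to the signed block, one for each of the `k + 1` representatives, form the term
      -- `s = 0`.
      rw [Finset.sum_add_distrib, Finset.sum_const, hx, smul_eq_mul, decreasingChainCount,
        Finset.sum_range_succ', add_comm, Nat.sub_zero]
      congr 1
      -- Exchange the sums over `j` and `i < j`: if `i` has rank `s` among the representatives, then
      -- `k + 1 - s` choices of `j` lie above it.
      rw [← Finset.sum_card_filter_le (x.reps.filter fun i : Fin n => (i : ℕ) + 1 ≤ b)
          (fun s => (k + 1 - s) * decreasingChainCount k s),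
        Finset.sum_comm' (t' := x.reps) (s' := fun i => x.reps.filter (i < ·)), Finset.sum_filter]
      · refine Finset.sum_congr rfl fun i hi => ?_
        rw [Finset.sum_const, smul_eq_mul]
        split_ifs with h
        · have h1 : (x.reps.filter fun i : Fin n => (i : ℕ) + 1 ≤ b).filter (· ≤ i) =
              x.reps.filter (· ≤ i) := by
            ext l
            simp only [Finset.mem_filter, Fin.le_def]
            exact ⟨fun h => ⟨h.1.1, h.2⟩, fun h => ⟨⟨h.1, by omega⟩, h.2⟩⟩
          have h2 := Finset.card_filter_add_card_filter_not (s := x.reps) (· ≤ i)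
          simp only [not_le, hx] at h2
          rw [h1]
          congr 1
          omega
        · rw [mul_zero]
      · intro i j
        simp only [Finset.mem_filter]
        tauto

end Label

end LabeledPartition

/-! ### Transfer to the posets with a top element -/

theorem List.IsChain.le_of_getLast? {α : Type*} [Preorder α] {l : List α} {t : α}
    (hl : l.IsChain (· ⋖ ·)) (ht : l.getLast? = some t) : ∀ a ∈ l, a ≤ t := by
  induction l with
  | nil => simp
  | cons b l ih =>
    rcases l with _ | ⟨c, l⟩
    · simp_all
    · rw [List.isChain_cons_cons] at hl
      rw [List.getLast?_cons_cons] at ht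
      have := ih hl.2 ht
      intro a ha
      rcases List.mem_cons.1 ha with rfl | ha
      · exact hl.1.le.trans (this c List.mem_cons_self)
      · exact this a ha

namespace LabeledPartition

variable {n : ℕ} {S : Type*}

/-- The embedding of the labeled partitions into a subposet of `Π_{n,S}` that contains them all. -/
def toSubposet (Q : Set (LabeledPartitionPoset n S)) (hQ : ∀ x, x ∈ Q) :
    LabeledPartition n S ↪o Q where
  toFun x := ⟨(x : LabeledPartitionPoset n S), hQ _⟩
  inj' _ _ h := WithTop.coe_injective (congrArg Subtype.val h)
  map_rel_iff' := WithTop.coe_le_coe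

theorem mem_range_toSubposet_of_le {Q : Set (LabeledPartitionPoset n S)} {hQ : ∀ x, x ∈ Q}
    {z : Q} {x : LabeledPartition n S} (h : z ≤ toSubposet Q hQ x) :
    z ∈ Set.range (toSubposet Q hQ) := by
  obtain ⟨y, hy, -⟩ := WithTop.le_coe_iff.1 (show z.1 ≤ (x : LabeledPartitionPoset n S) from h)
  exact ⟨y, Subtype.ext hy.symm⟩

/-- The labeled partitions form a lower set, so nothing outside them can come between two of them.
-/
theorem toSubposet_covBy_iff {Q : Set (LabeledPartitionPoset n S)} {hQ : ∀ x, x ∈ Q}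
    {x y : LabeledPartition n S} : toSubposet Q hQ x ⋖ toSubposet Q hQ y ↔ x ⋖ y := by
  refine Set.OrdConnected.apply_covBy_apply_iff (toSubposet Q hQ) ⟨?_⟩
  rintro _ - _ ⟨b, rfl⟩ z hz
  exact mem_range_toSubposet_of_le hz.2

theorem label_le_of_covBy [Fintype S] [LinearOrder S] [Unique S] {x y : LabeledPartition n S}
    (h : x ⋖ y) : label x y ≤ toLex (2, n) := by
  obtain ⟨⟨j, u⟩, hm, rfl⟩ := covBy_iff_exists_move.1 h
  rcases u with _ | ⟨i, c⟩
  · rw [label_move_none hm, Prod.Lex.toLex_le_toLex]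
    simp
  · cases c with
    | true =>
      rw [label_move_noncoherent hm, Prod.Lex.toLex_le_toLex]
      right
      simp only [true_and]
      omega
    | false =>
      obtain ⟨l, hl⟩ := exists_label_move_coherent hm
      rw [hl, Prod.Lex.toLex_le_toLex]
      simp

theorem decreasingMaximalChains_eq_image [Fintype S] [LinearOrder S] [Unique S]
    {Q : Set (LabeledPartitionPoset n S)} (hQ : ∀ x, x ∈ Q) (x t : LabeledPartition n S) :
    decreasingMaximalChains Q x t =
      (fun c => (x :: c).map (toSubposet Q hQ)) '' decreasingTails t x (toLex (2, n)) := by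
  have hlabel : ∀ l : List (LabeledPartition n S),
      List.zipWith (fun u v : Q => edgeLabel u.1 v.1) (l.map (toSubposet Q hQ))
        (l.map (toSubposet Q hQ)).tail = List.zipWith label l l.tail := by
    intro l
    rw [← List.map_tail, List.zipWith_map]
    rfl
  have hchain : ∀ l : List (LabeledPartition n S),
      (l.map (toSubposet Q hQ)).IsChain (· ⋖ ·) ↔ l.IsChain (· ⋖ ·) := by
    intro l
    rw [List.isChain_map]
    simp only [toSubposet_covBy_iff]
  have hlast : ∀ l : List (LabeledPartition n S),
      ((l.map (toSubposet Q hQ)).map Subtype.val).getLast? =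
        some (t : LabeledPartitionPoset n S) ↔ l.getLast? = some t := by
    intro l
    rw [List.map_map, List.getLast?_map]
    constructor
    · intro h
      obtain ⟨y, hy, hyt⟩ := Option.map_eq_some_iff.1 h
      rw [hy, WithTop.coe_injective hyt]
    · intro h
      rw [h]
      rfl
  -- All labels are at most `(2, n)`, so putting this bound in front of the word imposes no
  -- condition.
  have hbound : ∀ c : List (LabeledPartition n S), (x :: c).IsChain (· ⋖ ·) →
      ((toLex (2, n) :: List.zipWith label (x :: c) c).IsChain (· ≥ ·) ↔
        (List.zipWith label (x :: c) c).IsChain (· ≥ ·)) := by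
    intro c hc
    rcases c with _ | ⟨y, c⟩
    · simp
    · rw [List.zipWith_cons_cons, List.isChain_cons_cons]
      exact ⟨fun h => h.2, fun h => ⟨label_le_of_covBy (List.isChain_cons_cons.1 hc).1, h⟩⟩
  ext l
  constructor
  · rintro ⟨h1, h2, h3, h4⟩
    obtain ⟨y, hy, hyt⟩ := Option.map_eq_some_iff.1 (List.getLast?_map.symm.trans h2)
    obtain rfl : y = toSubposet Q hQ t := Subtype.ext hyt
    -- The chain stays below its last element, a labeled partition, so it never meets the added top.
    obtain ⟨l, rfl⟩ : l ∈ Set.range (List.map (toSubposet Q hQ)) := by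
      rw [Set.range_list_map]
      exact fun z hz => mem_range_toSubposet_of_le (h3.le_of_getLast? hy z hz)
    rcases l with _ | ⟨x', c⟩
    · simp at h1
    · obtain rfl : x' = x := WithTop.coe_injective (Option.some.inj h1)
      have h3' := (hchain _).1 h3
      rw [hlabel] at h4
      exact ⟨c, ⟨h3', (hlast _).1 h2, (hbound c h3').2 h4⟩, rfl⟩
  · rintro ⟨c, ⟨h1, h2, h3⟩, rfl⟩
    refine ⟨rfl, (hlast _).2 h2, (hchain _).2 h1, ?_⟩
    rw [hlabel]
    exact (hbound c h1).1 h3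

theorem ncard_decreasingMaximalChains [Fintype S] [LinearOrder S] [Unique S]
    {Q : Set (LabeledPartitionPoset n S)} (hQ : ∀ x, x ∈ Q) (σ : S) :
    (decreasingMaximalChains Q (zeroHat n S) (full n σ)).ncard = (2 * n - 1)‼ := by
  have hinj : Function.Injective fun c : List (LabeledPartition n S) =>
      (zeroHat n S :: c).map (toSubposet Q hQ) :=
    (List.map_injective_iff.2 (toSubposet Q hQ).injective).comp List.cons_injective
  rw [decreasingMaximalChains_eq_image hQ, Set.ncard_image_of_injective _ hinj,
    -- In `zeroHat` all `n` indices are representatives, and the bound `(2, n)` admits each of them.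
    (ncard_decreasingTails_eq (reps_full σ) n (zeroHat n S) (by simp [reps_zeroHat])).2 n,
    reps_zeroHat, Finset.filter_true_of_mem fun i _ => i.2, Finset.card_univ, Fintype.card_fin,
    decreasingChainCount_self]

end LabeledPartition

theorem mainTheorem7 (n : ℕ) :
    chainFormula n (fun π => (π.parts.card)!) = (increasingOrderedTrees n).ncard ∧
    ∀ {S : Type*} [Fintype S] [LinearOrder S] (σ : S), Fintype.card S = 1 →
      (decreasingMaximalChains (typeB n σ) ↑(LabeledPartition.zeroHat n S)
        ↑(LabeledPartition.full n σ)).ncard = (2 * n - 1)‼ ∧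
      (decreasingMaximalChains (typeC n S) ↑(LabeledPartition.zeroHat n S)
        ↑(LabeledPartition.full n σ)).ncard = (2 * n - 1)‼ := by
  refine ⟨(chainFormula_factorial n).trans (ncard_increasingOrderedTrees n).symm, ?_⟩
  intro S _ _ σ hS
  obtain ⟨_⟩ := Fintype.card_eq_one_iff_nonempty_unique.1 hS
  exact ⟨LabeledPartition.ncard_decreasingMaximalChains
      -- With a single sign the type `B` condition is vacuous, so both posets contain every element.
      (fun x π _ τ hτ => absurd (Subsingleton.elim τ σ) hτ) σ,
    LabeledPartition.ncard_decreasingMaximalChains (fun x => Set.mem_univ x) σ⟩
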